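/- Let $G$ be a finite, strongly connected directed graph (loops and multiple edges allowed) with vertex set $\mathcal V$ and at least one edge; the edge set is $\mathcal E$, and $e\in\mathcal E$ has initial vertex $s(e)$ and final vertex $r(e)$. Let $e^-$ and $e^+$ ($e\in\mathcal E$) be two disjoint copies of the edges. The graph inverse semigroup of $G$ is the semigroup with zero generated by $e^-,e^+$ $(e\in\mathcal E)$ and $P_u$ $(u\in\mathcal V)$ with relations $P_u^2=P_u$, $P_uP_w=0$ for $u\ne w$, $P_{s(e)}e^-=e^-=e^-P_{r(e)}$, $P_{r(e)}e^+=e^+=e^+P_{s(e)}$, $f^-f^+=P_{s(f)}$, and $f^-g^+=0$ for $f\neq g$. The Markov-Dyck shift $D_G$ is the set of bi-infinite sequences over the alphabet $\mathcal E^-\cup\mathcal E^+$ all of whose finite subwords have non-zero product in this semigroup. For $v\in\mathcal V$ let $X_v$ be the set of those $x\in D_G$ that contain no word $e^-e^+$ with $r(e)\neq v$ and no word $f^+g^-$ with $s(f)\ne v$. The topological entropy of a subshift $X$ is $h(X)=\lim_{n\to\infty}\frac1n\log\operatorname{card}\mathcal L_n(X)$, where $\mathcal L_n(X)$ is the set of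 words of length $n$ that appear in points of $X$. Let $A_G$ be the adjacency matrix of $G$ ($A_G(u,w)$ is the number of edges from $u$ to $w$), let $\rho$ be the inverse of its Perron eigenvalue (its spectral radius), let $p(z)=\det(I-A_Gz)$, let $p_v(z)$ be the determinant of $I-A_Gz$ with the $v$-th row and the $v$-th column deleted, and let $q_v=p/p_v$. **Theorem 3.4.** Let $v\in\mathcal V$ be such that $q_v(\rho^2)>\frac34$. Then the limit defining $h(X_v)$ exists and $$ h(X_v) > -\log\rho+\frac{p_v(\rho)\left[q_v(\rho^2)-\frac34-\frac12\sqrt{q_v(\rho^2)-\frac34}\right]}{\rho\,p'(\rho)\left[\rho+\sqrt{q_v(\rho^2)-\frac34}\right]}, $$ and the fraction on the right-hand side is positive. -/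

import Mathlib

open Filter Topology

/-- A directed graph with vertex set `V` and edge set `E`; loops and multiple edges are allowed.
`s e` is the initial and `r e` the final vertex of the edge `e`. -/
structure DirectedGraph (V E : Type*) where
  s : E → V
  r : E → V

/-- The alphabet `E⁻ ∪ E⁺`: two copies `e⁻`, `e⁺` of every edge. -/
inductive Letter (E : Type*) where
  | neg : E → Letter E
  | pos : E → Letter E

instance {E : Type*} [Finite E] : Finite (Letter E) :=
  Finite.of_surjective (fun a : E ⊕ E => a.elim Letter.neg Letter.pos) (by
    rintro (e | e)
    · exact ⟨Sum.inl e, rfl⟩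
    · exact ⟨Sum.inr e, rfl⟩)

/-- The generators `E⁻ ∪ {P_v : v ∈ V} ∪ E⁺` of the graph inverse semigroup. -/
inductive Generator (V E : Type*) where
  | vertex : V → Generator V E
  | letter : Letter E → Generator V E



/-- `𝓛_n(X)`: the words of length `n` that appear in some point of `X ⊆ Σ^ℤ`. -/
def languageOfLength {A : Type*} (X : Set (ℤ → A)) (n : ℕ) : Set (Fin n → A) :=
  {w | ∃ x ∈ X, ∃ i : ℤ, ∀ k : Fin n, w k = x (i + (k : ℕ))}

/-- `h` is the topological entropy of `X`: the limit of `(1/n) log card 𝓛_n(X)` exists and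
equals `h`. -/
def HasTopologicalEntropy {A : Type*} (X : Set (ℤ → A)) (h : ℝ) : Prop :=
  Tendsto (fun n : ℕ => (1 / (n : ℝ)) * Real.log ((languageOfLength X n).ncard : ℝ)) atTop (𝓝 h)


namespace DirectedGraph

variable {V E : Type*}

/-- Any two vertices are joined by a directed path. -/
def StronglyConnected (G : DirectedGraph V E) : Prop :=
  ∀ u w : V, Relation.ReflTransGen (fun a b => ∃ e : E, G.s e = a ∧ G.r e = b) u w

section GraphInverseSemigroup

/-- The free monoid with zero on the generators of the graph inverse semigroup. -/
abbrev FreeZero (V E : Type*) := WithZero (FreeMonoid (Generator V E))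

/-- The idempotent `P_v` as a free generator. -/
def freeP (E : Type*) {V : Type*} (v : V) : FreeZero V E :=
  ((FreeMonoid.of (Generator.vertex v) : FreeMonoid (Generator V E)) : FreeZero V E)

/-- A letter `e⁻` or `e⁺` as a free generator. -/
def freeLetter (V : Type*) {E : Type*} (a : Letter E) : FreeZero V E :=
  ((FreeMonoid.of (Generator.letter a) : FreeMonoid (Generator V E)) : FreeZero V E)

/-- The defining relations of the graph inverse semigroup. The copy `e⁻` runs from `s e` to `r e`
and `e⁺` from `r e` to `s e`, which is what the four relations with the `P_v` say; together
with `P_u P_w = 0` for `u ≠ w` they make every product of two letters that do not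
fit together vanish (`f⁻g⁻ = 0` for `r f ≠ s g`, `g⁺f⁻ = 0` for `s f ≠ s g`, and so on). -/
inductive InvRel (G : DirectedGraph V E) : FreeZero V E → FreeZero V E → Prop where
  | idem (u : V) : InvRel G (freeP E u * freeP E u) (freeP E u)
  | orth (u w : V) (h : u ≠ w) : InvRel G (freeP E u * freeP E w) 0
  | source_neg (e : E) :
      InvRel G (freeP E (G.s e) * freeLetter V (.neg e)) (freeLetter V (.neg e))
  | neg_range (e : E) :
      InvRel G (freeLetter V (.neg e) * freeP E (G.r e)) (freeLetter V (.neg e))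
  | range_pos (e : E) :
      InvRel G (freeP E (G.r e) * freeLetter V (.pos e)) (freeLetter V (.pos e))
  | pos_source (e : E) :
      InvRel G (freeLetter V (.pos e) * freeP E (G.s e)) (freeLetter V (.pos e))
  | neg_pos_same (e : E) :
      InvRel G (freeLetter V (.neg e) * freeLetter V (.pos e)) (freeP E (G.s e))
  | neg_pos_ne (f g : E) (h : f ≠ g) :
      InvRel G (freeLetter V (.neg f) * freeLetter V (.pos g)) 0

/-- The congruence generated by the defining relations. -/
def invCon (G : DirectedGraph V E) : Con (FreeZero V E) := conGen G.InvRel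

/-- The graph inverse semigroup of `G` (with an identity adjoined, the value of the empty
product). -/
abbrev GraphInverseSemigroup (G : DirectedGraph V E) := G.invCon.Quotient

/-- The zero element of the graph inverse semigroup. -/
def invZero (G : DirectedGraph V E) : G.GraphInverseSemigroup := ((0 : FreeZero V E) : G.invCon.Quotient)

/-- A letter as an element of the graph inverse semigroup. -/
def invLetter (G : DirectedGraph V E) (a : Letter E) : G.GraphInverseSemigroup :=
  (freeLetter V a : G.invCon.Quotient)

/-- A word is Dyck-admissible if its product in the graph inverse semigroup is not zero. -/
def Admissible (G : DirectedGraph V E) (w : List (Letter E)) : Prop :=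
  (w.map G.invLetter).prod ≠ G.invZero

end GraphInverseSemigroup

/-- The Markov-Dyck shift `D_G`: the bi-infinite sequences all of whose finite subwords are
admissible. -/
def markovDyckShift (G : DirectedGraph V E) : Set (ℤ → Letter E) :=
  {x | ∀ (i : ℤ) (n : ℕ), G.Admissible (List.ofFn fun k : Fin n => x (i + (k : ℕ)))}

/-- The subsystem `X_v` of `D_G`: the words `e⁻e⁺` with `r e ≠ v` and the words `f⁺g⁻` with
`s f ≠ v` are excluded. -/
def turnShift (G : DirectedGraph V E) (v : V) : Set (ℤ → Letter E) :=
  {x | x ∈ G.markovDyckShift ∧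
    (∀ (i : ℤ) (e : E), G.r e ≠ v → ¬ (x i = .neg e ∧ x (i + 1) = .pos e)) ∧
    (∀ (i : ℤ) (f g : E), G.s f ≠ v → ¬ (x i = .pos f ∧ x (i + 1) = .neg g))}

/-- The adjacency matrix `A_G`: `A_G(u, w)` is the number of edges from `u` to `w`. -/
noncomputable def adjacencyMatrix (G : DirectedGraph V E) : Matrix V V ℝ :=
  Matrix.of fun u w => (Nat.card {e : E // G.s e = u ∧ G.r e = w} : ℝ)

variable [Fintype V] [DecidableEq V]

/-- The Perron eigenvalue of `A_G`: its spectral radius, the largest modulus of a complex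
eigenvalue. -/
noncomputable def perronEigenvalue (G : DirectedGraph V E) : ℝ :=
  (spectralRadius ℂ (G.adjacencyMatrix.map (algebraMap ℝ ℂ))).toReal

/-- `ρ`, the inverse of the Perron eigenvalue. -/
noncomputable def rho (G : DirectedGraph V E) : ℝ := (G.perronEigenvalue)⁻¹

/-- `p(z) = det (I - A_G z)`, as a polynomial. -/
noncomputable def detPoly (G : DirectedGraph V E) : Polynomial ℝ :=
  (1 - (Polynomial.X : Polynomial ℝ) • G.adjacencyMatrix.map Polynomial.C).det

/-- `p_v(z)`: the determinant of `I - A_G z` with the `v`-th row and column deleted. -/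
noncomputable def minorPoly (G : DirectedGraph V E) (v : V) : Polynomial ℝ :=
  ((1 - (Polynomial.X : Polynomial ℝ) • G.adjacencyMatrix.map Polynomial.C).submatrix
    (Subtype.val : {u : V // u ≠ v} → V) (Subtype.val : {u : V // u ≠ v} → V)).det

/-- `q_v = p / p_v`. -/
noncomputable def q (G : DirectedGraph V E) (v : V) (z : ℝ) : ℝ :=
  G.detPoly.eval z / (G.minorPoly v).eval z

/-- The increment over `-log ρ` in the lower bound for the entropy of `X_v`. -/
noncomputable def entropyGain (G : DirectedGraph V E) (v : V) : ℝ :=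
  ((G.minorPoly v).eval G.rho *
      (G.q v (G.rho ^ 2) - 3 / 4 - 1 / 2 * Real.sqrt (G.q v (G.rho ^ 2) - 3 / 4))) /
    (G.rho * G.detPoly.derivative.eval G.rho *
      (G.rho + Real.sqrt (G.q v (G.rho ^ 2) - 3 / 4)))

end DirectedGraph

/-! Let f(z) be the generating function of the first-return loops at v, by length. Reading a loop c
forwards as c⁻ and backwards as c⁺, Dyck words in these brackets have a generating function D(z)
with D = 1 + f(z²)D². The products d₁c₁⁺d₂c₂⁺⋯ of Dyck words and closing brackets have the series S
= 1 + D(z)f(z)S. These words change sign only at v, parse uniquely and occur in X_v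
(`chainWord_injective`, `tsum_chainWord_le`). So if ∑ card 𝓛ₙ(X_v) zⁿ converges, then S is finite,
Df < 1, and the quadratic equation for D gives f(z) < 1/2 + √(1/4 - f(z²))
(`firstHitSum_lt_of_tsum_ne_top`).

On the other side stands the renewal identity p = p_v(1 - f) (`detPoly_eval_eq`), which gives q_v =
1 - f on (0, ρ]. A maximum principle (`le_mul_of_subharmonic`) yields p_v > 0 there and f(ρ) = 1
(`loopSum_rho`). Put t = √(q_v(ρ²) - 3/4), so that t² = 1/4 - f(ρ²), and let f'(ρ) = -p'(ρ)/p_v(ρ)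
be the left derivative. Convexity of f bounds f(x) below by its tangent at ρ, and bounds the drop
from f(ρ²) to f(x²) by f'(ρ)(ρ² - x²). Hence the opposite inequality f(x) > 1/2 + √(1/4 - f(x²))
holds for ρ(1 - gain) < x < ρ (`lt_loopSum`).

If h(X_v) were at most -log ρ + gain, the language series would converge at every positive x <
ρe^{-gain}. Since 1 - gain < e^{-gain}, some x satisfies both inequalities, a contradiction. -/

/-- Partial self-maps of `S`; the product `f * g` applies `f` first. -/
def PartialMap (S : Type*) := S → Option S

namespace PartialMap

variable {S : Type*}

instance : MonoidWithZero (PartialMap S) where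
  mul f g := fun s => (f s).bind fun t => g t
  one := fun s => some s
  zero := fun _ => none
  mul_assoc f g h := funext fun s => Option.bind_assoc (f s) g h
  one_mul f := rfl
  mul_one f := funext fun s => Option.bind_fun_some (f s)
  zero_mul f := rfl
  mul_zero f := funext fun s => Option.bind_fun_none (f s)

theorem mul_apply (f g : PartialMap S) (s : S) : (f * g) s = (f s).bind fun t => g t := rfl

theorem zero_apply (s : S) : (0 : PartialMap S) s = none := rfl

end PartialMap

namespace DirectedGraph

variable {V E : Type*}

/-! ### The graph inverse semigroup acting on stacks -/

section StackAction

open Classical in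
/-- The action of a letter on a vertex with a stack of edges: `e⁻` pushes `e`, `e⁺` pops it. -/
noncomputable def stackStep (G : DirectedGraph V E) : Letter E → PartialMap (V × List E)
  | .neg e => fun x => if x.1 = G.s e then some (G.r e, e :: x.2) else none
  | .pos e => fun x => if x.1 = G.r e ∧ x.2.head? = some e then some (G.s e, x.2.tail) else none

open Classical in
/-- The action of a generator of the graph inverse semigroup on a vertex with a stack of edges. -/
noncomputable def stackGen (G : DirectedGraph V E) : Generator V E → PartialMap (V × List E)
  | .vertex u => fun x => if x.1 = u then some x else none
  | .letter a => G.stackStep a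

/-- The action of the free monoid with zero on stacks. -/
noncomputable def stackFree (G : DirectedGraph V E) :
    FreeZero V E →*₀ PartialMap (V × List E) :=
  WithZero.lift' (FreeMonoid.lift G.stackGen)

theorem stackFree_freeP (G : DirectedGraph V E) (u : V) :
    G.stackFree (freeP E u) = G.stackGen (.vertex u) := by
  simp [stackFree, freeP]

theorem stackFree_freeLetter (G : DirectedGraph V E) (a : Letter E) :
    G.stackFree (freeLetter V a) = G.stackStep a := by
  simp [stackFree, freeLetter, stackGen]

/-- Pushing f and then popping g undoes the push if f = g and is undefined otherwise; the vertex
idempotents restrict to one vertex. The action therefore descends to the semigroup and detects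
non-zero products without normal forms. -/
theorem stackFree_rel (G : DirectedGraph V E) {a b : FreeZero V E} (h : G.InvRel a b) :
    G.stackFree a = G.stackFree b := by
  cases h <;>
    simp only [map_mul, stackFree_freeP, stackFree_freeLetter, map_zero] <;>
    funext ⟨x, l⟩ <;>
    (try rw [PartialMap.mul_apply]) <;>
    simp only [PartialMap.zero_apply, stackGen, stackStep]
  case idem u => by_cases h : x = u <;> simp [h]
  case orth u w h => 
    by_cases hx : x = u
    · simp [hx, h]
    · simp [hx]
  case source_neg e => by_cases h : x = G.s e <;> simp [h]
  case neg_range e => by_cases h : x = G.s e <;> simp [h]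
  case range_pos e =>
    by_cases h : x = G.r e
    · subst h; simp
    · simp [h]
  case pos_source e => by_cases h : x = G.r e ∧ l.head? = some e <;> simp [h]
  case neg_pos_same e => by_cases h : x = G.s e <;> simp [h]
  case neg_pos_ne f g h =>
    by_cases hx : x = G.s f <;> simp [hx, h]

/-- The action of the graph inverse semigroup on stacks. -/
noncomputable def stackHom (G : DirectedGraph V E) :
    G.GraphInverseSemigroup →* PartialMap (V × List E) :=
  G.invCon.lift G.stackFree.toMonoidHom
    (Con.conGen_le.2 fun _ _ h => by simpa [Con.ker_rel] using G.stackFree_rel h)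

/-- Run a word on a vertex with a stack. -/
noncomputable def run (G : DirectedGraph V E) (w : List (Letter E)) : PartialMap (V × List E) :=
  (w.map G.stackStep).prod

theorem run_append (G : DirectedGraph V E) (w w' : List (Letter E)) (x : V × List E) :
    G.run (w ++ w') x = (G.run w x).bind fun y => G.run w' y := by
  simp [run, PartialMap.mul_apply]

theorem run_cons (G : DirectedGraph V E) (a : Letter E) (w : List (Letter E)) (x : V × List E) :
    G.run (a :: w) x = (G.stackStep a x).bind fun y => G.run w y := by
  simp [run, PartialMap.mul_apply]

theorem run_nil (G : DirectedGraph V E) (x : V × List E) : G.run [] x = some x := rfl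

theorem stackHom_invLetter (G : DirectedGraph V E) (a : Letter E) :
    G.stackHom (G.invLetter a) = G.stackStep a :=
  G.stackFree_freeLetter a

theorem stackHom_invZero (G : DirectedGraph V E) : G.stackHom G.invZero = 0 :=
  map_zero G.stackFree

/-- A word that can be run on some stack is admissible. -/
theorem admissible_of_run_ne_none (G : DirectedGraph V E) {w : List (Letter E)} {x : V × List E}
    (h : G.run w x ≠ none) : G.Admissible w := by
  intro h0
  apply h
  have h1 := congrArg G.stackHom h0
  rw [map_list_prod, stackHom_invZero, List.map_map] at h1
  have h2 : (G.stackHom ∘ G.invLetter) = G.stackStep := funext G.stackHom_invLetter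
  rw [h2] at h1
  exact congrFun h1 x

theorem admissible_of_infix (G : DirectedGraph V E) {w w' : List (Letter E)} {x : V × List E}
    (h : G.run w x ≠ none) (hw : w' <:+: w) : G.Admissible w' := by
  obtain ⟨a, b, rfl⟩ := hw
  rw [run_append, run_append] at h
  cases ha : G.run a x with
  | none => simp [ha] at h
  | some y =>
    refine G.admissible_of_run_ne_none (x := y) fun h' => ?_
    simp [ha, h'] at h

end StackAction

/-! ### Words that change sign at v and their effect on stacks -/

section Words

/-- The endpoint of a letter. -/
def letterEnd (G : DirectedGraph V E) : Letter E → V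
  | .neg e => G.r e
  | .pos e => G.s e

/-- Two consecutive letters change sign at `v` only. -/
def TurnRel (G : DirectedGraph V E) (v : V) : Letter E → Letter E → Prop
  | .neg e, .pos _ => G.r e = v
  | .pos e, .neg _ => G.s e = v
  | _, _ => True

theorem TurnRel.of_letterEnd {G : DirectedGraph V E} {v : V} {a : Letter E}
    (h : G.letterEnd a = v) (b : Letter E) : G.TurnRel v a b := by
  cases a <;> cases b <;> simp_all [TurnRel, letterEnd]

/-- A word that changes sign at `v` only and ends at `v`. -/
def TurnWord (G : DirectedGraph V E) (v : V) (w : List (Letter E)) : Prop :=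
  w.IsChain (G.TurnRel v) ∧ ∀ a ∈ w.getLast?, G.letterEnd a = v

theorem TurnWord.nil (G : DirectedGraph V E) (v : V) : G.TurnWord v [] := by
  simp [TurnWord]

theorem TurnWord.append {G : DirectedGraph V E} {v : V} {w w' : List (Letter E)}
    (h : G.TurnWord v w) (h' : G.TurnWord v w') : G.TurnWord v (w ++ w') := by
  -- At the seam the left word ends at v, so any letter may follow.
  refine ⟨h.1.append h'.1 fun a ha b _ => .of_letterEnd (h.2 a ha) b, fun a ha => ?_⟩
  rw [List.getLast?_append] at ha
  cases h1 : w'.getLast? with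
  | none => exact h.2 a (by simpa [h1] using ha)
  | some b => exact h'.2 a (by simpa [h1] using ha)

/-- The word `w` turns the stack `a` at `v` into the stack `b` at `v`. -/
def Transfers (G : DirectedGraph V E) (v : V) (w : List (Letter E)) (a b : List E) : Prop :=
  ∀ l, G.run w (v, a ++ l) = some (v, b ++ l)

theorem Transfers.append {G : DirectedGraph V E} {v : V} {w w' : List (Letter E)}
    {a b c : List E} (h : G.Transfers v w a b) (h' : G.Transfers v w' b c) :
    G.Transfers v (w ++ w') a c := fun l => by
  rw [run_append, h l]; exact h' l

theorem Transfers.frame {G : DirectedGraph V E} {v : V} {w : List (Letter E)}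
    {a b : List E} (h : G.Transfers v w a b) (q : List E) :
    G.Transfers v w (a ++ q) (b ++ q) := fun l => by
  simpa using h (q ++ l)

theorem Transfers.nil (G : DirectedGraph V E) (v : V) (a : List E) :
    G.Transfers v [] a a := fun _ => rfl

/-- A word from `v` to `v` that changes sign at `v` only and removes a stack of edges. -/
def GoodWord (G : DirectedGraph V E) (v : V) (w : List (Letter E)) : Prop :=
  G.TurnWord v w ∧ ∃ q, G.Transfers v w q []

theorem GoodWord.append {G : DirectedGraph V E} {v : V} {w w' : List (Letter E)}
    (h : G.GoodWord v w) (h' : G.GoodWord v w') : G.GoodWord v (w ++ w') := by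
  obtain ⟨h1, q, h2⟩ := h
  obtain ⟨h1', q', h2'⟩ := h'
  exact ⟨h1.append h1', q ++ q', (h2.frame q').append h2'⟩

theorem GoodWord.flatten_replicate {G : DirectedGraph V E} {v : V} {w : List (Letter E)}
    (h : G.GoodWord v w) (K : ℕ) : G.GoodWord v (List.replicate K w).flatten := by
  induction K with
  | zero => exact ⟨.nil G v, [], .nil G v []⟩
  | succ K ih =>
    rw [List.replicate_succ, List.flatten_cons]
    exact h.append ih

end Words

/-! ### Periodic points of the shift -/

section Periodic

variable {A : Type*}

/-- The periodic sequence with period `w`. -/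
def periodicSeq (w : List A) (hw : w ≠ []) (i : ℤ) : A :=
  w[(i % w.length).toNat]'(by
    have : (0 : ℤ) < w.length := by exact_mod_cast List.length_pos_iff.2 hw
    have h1 := Int.emod_nonneg i this.ne'
    have h2 := Int.emod_lt_of_pos i this
    omega)

theorem periodicSeq_add_length_mul (w : List A) (hw : w ≠ []) (i k : ℤ) :
    periodicSeq w hw (i + w.length * k) = periodicSeq w hw i := by
  simp [periodicSeq]

theorem getElem_flatten_replicate (w : List A) (hw : w ≠ []) (K j : ℕ)
    (hj : j < (List.replicate K w).flatten.length) :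
    (List.replicate K w).flatten[j] = periodicSeq w hw j := by
  induction K generalizing j with
  | zero => simp at hj
  | succ K ih =>
    simp only [List.replicate_succ, List.flatten_cons] at hj ⊢
    rw [List.getElem_append]
    split_ifs with h
    · simp only [periodicSeq]
      congr 1
      rw [Int.emod_eq_of_lt (by positivity) (by exact_mod_cast h)]
      simp
    · rw [ih]
      rw [← periodicSeq_add_length_mul w hw _ 1]
      congr 1
      push_cast [not_lt.1 h]
      ring

theorem ofFn_periodicSeq_infix (w : List A) (hw : w ≠ []) (i : ℤ) (n : ℕ) :
    ∃ K, (List.ofFn fun k : Fin n => periodicSeq w hw (i + (k : ℕ))) <:+: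
      (List.replicate K w).flatten := by
  have hpos : (0 : ℤ) < w.length := by exact_mod_cast List.length_pos_iff.2 hw
  have h1 := Int.emod_nonneg i hpos.ne'
  obtain ⟨j, hj⟩ := Int.eq_ofNat_of_zero_le h1
  -- The window starts at the residue j of i; since w is nonempty, j + n copies have length at least
  -- j + n.
  refine ⟨j + n, ?_⟩
  have hlen : j + n ≤ (List.replicate (j + n) w).flatten.length := by
    simp only [List.length_flatten, List.map_replicate, List.sum_replicate, smul_eq_mul]
    exact Nat.le_mul_of_pos_right _ (List.length_pos_iff.2 hw)
  have : (List.ofFn fun k : Fin n => periodicSeq w hw (i + (k : ℕ))) =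
      ((List.replicate (j + n) w).flatten.drop j).take n := by
    apply List.ext_getElem
    · simp only [List.length_ofFn, List.length_take, List.length_drop]; omega
    · intro k hk hk'
      rw [List.getElem_ofFn, List.getElem_take, List.getElem_drop,
        getElem_flatten_replicate w hw]
      have h3 : i + (k : ℤ) = ((j + k : ℕ) : ℤ) + w.length * (i / w.length) := by
        have := Int.emod_add_mul_ediv i w.length
        push_cast; omega
      simp only [h3, periodicSeq_add_length_mul]
  rw [this]
  exact (List.take_prefix _ _).isInfix.trans (List.drop_suffix _ _).isInfix

theorem periodicSeq_natCast (w : List A) (hw : w ≠ []) (k : ℕ) (hk : k < w.length) :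
    periodicSeq w hw k = w[k] := by
  simp only [periodicSeq]
  congr 1
  rw [Int.emod_eq_of_lt (by positivity) (by exact_mod_cast hk)]
  simp

/-- Every finite window lies inside a power of w. Powers of a good word are good, so they run on a
deep enough stack and every factor of them is admissible. -/
theorem GoodWord.periodicSeq_mem {G : DirectedGraph V E} {v : V} {w : List (Letter E)}
    (h : G.GoodWord v w) (hw : w ≠ []) : periodicSeq w hw ∈ G.turnShift v := by
  have key : ∀ i : ℤ, G.TurnRel v (periodicSeq w hw i) (periodicSeq w hw (i + 1)) := by
    intro i
    obtain ⟨K, hK⟩ := ofFn_periodicSeq_infix w hw i 2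
    have := (h.flatten_replicate K).1.1.infix hK
    simpa [List.ofFn_succ] using this
  refine ⟨fun i n => ?_, fun i e he hi => ?_, fun i f g hf hi => ?_⟩
  · obtain ⟨K, hK⟩ := ofFn_periodicSeq_infix w hw i n
    obtain ⟨-, q, hq⟩ := h.flatten_replicate K
    exact G.admissible_of_infix (x := (v, q ++ [])) (by rw [hq []]; simp) hK
  · have := key i
    rw [hi.1, hi.2] at this
    exact he this
  · have := key i
    rw [hi.1, hi.2] at this
    exact hf this

theorem GoodWord.get_mem_language {G : DirectedGraph V E} {v : V} {w : List (Letter E)}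
    (h : G.GoodWord v w) (hw : w ≠ []) : w.get ∈ languageOfLength (G.turnShift v) w.length :=
  ⟨_, h.periodicSeq_mem hw, 0, fun k => by
    rw [zero_add, periodicSeq_natCast w hw k k.2]; rfl⟩

end Periodic

end DirectedGraph

/-! ### Sums over lists and binary trees -/

open scoped ENNReal in
theorem ENNReal.tsum_of_equiv_unit_sum {X Y : Type*} (e : Unit ⊕ X ≃ Y) (F : Y → ℝ≥0∞) :
    ∑' y, F y = F (e (.inl ())) + ∑' x, F (e (.inr x)) := by
  rw [← e.tsum_eq, Summable.tsum_sum ENNReal.summable ENNReal.summable]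
  simp

open scoped ENNReal in
theorem ENNReal.tsum_list {α : Type*} (F : List α → ℝ≥0∞) :
    ∑' l, F l = F [] + ∑' (a : α) (l : List α), F (a :: l) := by
  let e : Unit ⊕ (α × List α) ≃ List α :=
    { toFun := fun x => x.elim (fun _ => []) fun p => p.1 :: p.2
      invFun := fun l => match l with
        | [] => .inl ()
        | a :: l => .inr (a, l)
      left_inv := by rintro (_ | ⟨a, l⟩) <;> rfl
      right_inv := by rintro (_ | ⟨a, l⟩) <;> rfl }
  rw [ENNReal.tsum_of_equiv_unit_sum e, ENNReal.tsum_prod']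
  rfl

/-- Dyck words over an alphabet of brackets, as binary trees. -/
inductive DyckTree (C : Type*) where
  | leaf : DyckTree C
  | node : C → DyckTree C → DyckTree C → DyckTree C

open scoped ENNReal in
theorem DyckTree.tsum_eq {C : Type*} (F : DyckTree C → ℝ≥0∞) :
    ∑' d, F d = F .leaf + ∑' (c : C) (a : DyckTree C) (b : DyckTree C), F (.node c a b) := by
  let e : Unit ⊕ (C × DyckTree C × DyckTree C) ≃ DyckTree C :=
    { toFun := fun x => x.elim (fun _ => .leaf) fun p => .node p.1 p.2.1 p.2.2
      invFun := fun d => match d with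
        | .leaf => .inl ()
        | .node c a b => .inr (c, a, b)
      left_inv := by rintro (_ | ⟨c, a, b⟩) <;> rfl
      right_inv := by rintro (_ | ⟨c, a, b⟩) <;> rfl }
  rw [ENNReal.tsum_of_equiv_unit_sum e, ENNReal.tsum_prod']
  simp_rw [ENNReal.tsum_prod']
  rfl

namespace DirectedGraph

variable {V E : Type*}

/-! ### First-hit paths as a prefix and suffix code -/

section FirstHit

/-- `l` is a nonempty path from `u` that visits `v` at its end, and nowhere in between. -/
def FirstHit (G : DirectedGraph V E) (v : V) : List E → V → Prop
  | [], _ => False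
  | e :: l, u => G.s e = u ∧ ((G.r e = v ∧ l = []) ∨ (G.r e ≠ v ∧ G.FirstHit v l (G.r e)))

variable {G : DirectedGraph V E} {v : V}

theorem FirstHit.ne_nil {l : List E} {u : V} (h : G.FirstHit v l u) : l ≠ [] := by
  rintro rfl; exact h

/-- The path stops at its first visit to v, so first-hit paths from one vertex form a prefix code.
-/
theorem FirstHit.eq_nil_of_append {l m : List E} {u : V} (h : G.FirstHit v l u)
    (h' : G.FirstHit v (l ++ m) u) : m = [] := by
  induction l generalizing u with
  | nil => exact h.elim
  | cons e l ih =>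
    rcases h with ⟨-, ⟨h1, rfl⟩ | ⟨h1, h2⟩⟩
    · rcases h' with ⟨-, ⟨-, h3⟩ | ⟨h3, -⟩⟩
      · exact h3
      · exact (h3 h1).elim
    · rcases h' with ⟨-, ⟨h3, -⟩ | ⟨-, h3⟩⟩
      · exact (h1 h3).elim
      · exact ih h2 h3

/-- A proper suffix that starts at v would be an interior visit to v. This suffix-code property
serves the words `posWord`, which read loops backwards. -/
theorem FirstHit.eq_nil_of_append_left {l m : List E} {u : V} (h : G.FirstHit v l v)
    (h' : G.FirstHit v (m ++ l) u) : m = [] := by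
  induction m generalizing u with
  | nil => rfl
  | cons e m ih =>
    exfalso
    rcases h' with ⟨-, ⟨-, h2⟩ | ⟨h1, h2⟩⟩
    · exact h.ne_nil (List.append_eq_nil_iff.1 h2).2
    · obtain rfl := ih h2
      cases l with
      | nil => exact h
      | cons e' l => exact h1 (h2.1.symm.trans h.1)

/-- The word `e₁⁻ ⋯ eₖ⁻`. -/
def negWord (l : List E) : List (Letter E) := l.map .neg

/-- The word `eₖ⁺ ⋯ e₁⁺`. -/
def posWord (l : List E) : List (Letter E) := l.reverse.map .pos

theorem length_negWord (l : List E) : (negWord l).length = l.length := by simp [negWord]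

theorem length_posWord (l : List E) : (posWord l).length = l.length := by simp [posWord]

theorem FirstHit.negWord_unique {l l' : List E} {X Y : List (Letter E)} {u : V}
    (h : G.FirstHit v l u) (h' : G.FirstHit v l' u) (he : negWord l ++ X = negWord l' ++ Y) :
    l = l' := by
  have hinj : Function.Injective (Letter.neg : E → Letter E) := fun _ _ h => by cases h; rfl
  rcases List.append_eq_append_iff.1 he with ⟨m, hm, -⟩ | ⟨m, hm, -⟩
  · obtain ⟨a, b, rfl, ha, -⟩ := List.map_eq_append_iff.1 hm
    obtain rfl := hinj.list_map ha
    simp [h.eq_nil_of_append h']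
  · obtain ⟨a, b, rfl, ha, -⟩ := List.map_eq_append_iff.1 hm
    obtain rfl := hinj.list_map ha
    simp [h'.eq_nil_of_append h]

theorem FirstHit.posWord_unique {l l' : List E} {X Y : List (Letter E)}
    (h : G.FirstHit v l v) (h' : G.FirstHit v l' v) (he : posWord l ++ X = posWord l' ++ Y) :
    l = l' := by
  have hinj : Function.Injective (Letter.pos : E → Letter E) := fun _ _ h => by cases h; rfl
  have key : ∀ {l l' : List E} {m : List (Letter E)}, G.FirstHit v l v → G.FirstHit v l' v →
      posWord l' = posWord l ++ m → l = l' := by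
    intro l l' m h h' hm
    obtain ⟨a, b, hab, ha, -⟩ := List.map_eq_append_iff.1 hm
    obtain rfl := hinj.list_map ha
    obtain rfl : l' = b.reverse ++ l := by simpa using congrArg List.reverse hab
    simp [h.eq_nil_of_append_left h']
  rcases List.append_eq_append_iff.1 he with ⟨m, hm, -⟩ | ⟨m, hm, -⟩
  · exact key h h' hm
  · exact (key h' h hm).symm

theorem FirstHit.run_negWord {l : List E} {u : V} (h : G.FirstHit v l u) (q : List E) :
    G.run (negWord l) (u, q) = some (v, l.reverse ++ q) := by
  induction l generalizing u q with
  | nil => exact h.elim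
  | cons e l ih =>
    rw [negWord, List.map_cons, run_cons]
    rcases h with ⟨rfl, ⟨rfl, rfl⟩ | ⟨h1, h2⟩⟩
    · simp [stackStep, run_nil]
    · have := ih h2 (e :: q)
      simp only [negWord] at this
      simp [stackStep, this]

theorem FirstHit.run_posWord {l : List E} {u : V} (h : G.FirstHit v l u) (q : List E) :
    G.run (posWord l) (v, l.reverse ++ q) = some (u, q) := by
  induction l generalizing u q with
  | nil => exact h.elim
  | cons e l ih =>
    have h0 : posWord (e :: l) = posWord l ++ [.pos e] := by simp [posWord]
    rw [h0, run_append]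
    rcases h with ⟨rfl, ⟨rfl, rfl⟩ | ⟨h1, h2⟩⟩
    · simp [stackStep, run_nil, posWord, run_cons]
    · have := ih h2 (e :: q)
      simp [this, run_cons, stackStep, run_nil]

theorem FirstHit.turnWord_negWord {l : List E} {u : V} (h : G.FirstHit v l u) :
    G.TurnWord v (negWord l) := by
  constructor
  · rw [negWord, List.isChain_map]
    exact List.Pairwise.isChain (List.pairwise_of_forall fun _ _ => trivial)
  · induction l generalizing u with
    | nil => exact h.elim
    | cons e l ih =>
      rcases h with ⟨rfl, ⟨h1, rfl⟩ | ⟨h1, h2⟩⟩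
      · simpa [negWord, letterEnd] using h1
      · intro a ha
        refine ih h2 a ?_
        rw [negWord, List.map_cons, List.getLast?_cons_of_ne_nil] at ha
        · exact ha
        · simpa using h2.ne_nil

theorem FirstHit.turnWord_posWord {l : List E} (h : G.FirstHit v l v) :
    G.TurnWord v (posWord l) := by
  constructor
  · rw [posWord, List.isChain_map]
    exact List.Pairwise.isChain (List.pairwise_of_forall fun _ _ => trivial)
  · cases l with
    | nil => exact h.elim
    | cons e l =>
      intro a ha
      simp [posWord] at ha
      subst ha
      exact h.1

/-- The first-return loops at `v`. -/
abbrev Loop (G : DirectedGraph V E) (v : V) := {l : List E // G.FirstHit v l v}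

end FirstHit

/-! ### Unique parsing of Dyck words and chains -/

section DyckWords

variable {G : DirectedGraph V E} {v : V}

/-- The Dyck word of a tree of loops at `v`. -/
def dyckWord : DyckTree (G.Loop v) → List (Letter E)
  | .leaf => []
  | .node c a b => negWord c.1 ++ (dyckWord a ++ (posWord c.1 ++ dyckWord b))

/-- The word `d₁ c₁⁺ d₂ c₂⁺ ⋯` of a sequence of Dyck words and loops. -/
def chainWord : List (DyckTree (G.Loop v) × G.Loop v) → List (Letter E)
  | [] => []
  | p :: t => dyckWord p.1 ++ (posWord p.2.1 ++ chainWord t)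

theorem turnWord_dyckWord (d : DyckTree (G.Loop v)) : G.TurnWord v (dyckWord d) := by
  induction d with
  | leaf => exact .nil G v
  | node c a b iha ihb =>
    exact c.2.turnWord_negWord.append (iha.append (c.2.turnWord_posWord.append ihb))

theorem transfers_dyckWord (d : DyckTree (G.Loop v)) : G.Transfers v (dyckWord d) [] [] := by
  induction d with
  | leaf => exact .nil G v []
  | node c a b iha ihb =>
    have h1 : G.Transfers v (negWord c.1) [] c.1.reverse := fun l => c.2.run_negWord l
    have h2 : G.Transfers v (posWord c.1) c.1.reverse [] := fun l => c.2.run_posWord l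
    exact h1.append ((iha.frame _).append (h2.append ihb))

theorem goodWord_chainWord (t : List (DyckTree (G.Loop v) × G.Loop v)) :
    G.GoodWord v (chainWord t) := by
  induction t with
  | nil => exact ⟨.nil G v, [], .nil G v []⟩
  | cons p t ih =>
    have h2 : G.Transfers v (posWord p.2.1) p.2.1.reverse [] := fun l => p.2.2.run_posWord l
    have h3 : G.GoodWord v (dyckWord p.1) :=
      ⟨turnWord_dyckWord p.1, [], transfers_dyckWord p.1⟩
    have h4 : G.GoodWord v (posWord p.2.1) := ⟨p.2.2.turnWord_posWord, _, h2⟩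
    exact h3.append (h4.append ih)

/-- The word does not start with a letter `e⁻`. -/
def NotStartsNeg (x : List (Letter E)) : Prop := ∀ e, x.head? ≠ some (.neg e)

theorem FirstHit.notStartsNeg_posWord {l : List E} {u : V} (h : G.FirstHit v l u)
    (x : List (Letter E)) : NotStartsNeg (posWord l ++ x) := by
  intro e
  cases hl : l.reverse with
  | nil => exact (h.ne_nil (List.reverse_eq_nil_iff.1 hl)).elim
  | cons e' l' => simp [posWord, hl]

theorem FirstHit.not_notStartsNeg_negWord {l : List E} {u : V} (h : G.FirstHit v l u)
    (x : List (Letter E)) : ¬ NotStartsNeg (negWord l ++ x) := by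
  cases l with
  | nil => exact h.elim
  | cons e l => exact fun H => H e (by simp [negWord])

/-- A first letter e⁻ distinguishes a node from a leaf, the prefix code then determines the loop,
and the two subtrees follow recursively. The remainder must not start with e⁻, since otherwise the
end of the Dyck word could not be recognised. -/
theorem dyckWord_append_unique {d d' : DyckTree (G.Loop v)} {x y : List (Letter E)}
    (hx : NotStartsNeg x) (hy : NotStartsNeg y) (h : dyckWord d ++ x = dyckWord d' ++ y) :
    d = d' ∧ x = y := by
  induction d generalizing d' x y with
  | leaf =>
    cases d' with
    | leaf => exact ⟨rfl, h⟩
    | node c a b =>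
      simp only [dyckWord, List.nil_append, List.append_assoc] at h
      exact (c.2.not_notStartsNeg_negWord _ (h ▸ hx)).elim
  | node c a b iha ihb =>
    cases d' with
    | leaf =>
      simp only [dyckWord, List.nil_append, List.append_assoc] at h
      exact (c.2.not_notStartsNeg_negWord _ (h ▸ hy)).elim
    | node c' a' b' =>
      simp only [dyckWord, List.append_assoc] at h
      obtain rfl : c = c' := Subtype.ext (c.2.negWord_unique c'.2 h)
      obtain ⟨rfl, h2⟩ := iha (c.2.notStartsNeg_posWord _) (c.2.notStartsNeg_posWord _)
        (List.append_cancel_left h)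
      obtain ⟨rfl, h3⟩ := ihb hx hy (List.append_cancel_left h2)
      exact ⟨rfl, h3⟩

theorem chainWord_injective :
    Function.Injective (chainWord : List (DyckTree (G.Loop v) × G.Loop v) → _) := by
  have hne : ∀ (p : DyckTree (G.Loop v) × G.Loop v) t, chainWord (p :: t) ≠ [] := by
    intro p t h
    have := (List.append_eq_nil_iff.1 (List.append_eq_nil_iff.1 h).2).1
    exact p.2.2.ne_nil (by simpa [posWord] using this)
  intro t
  induction t with
  | nil =>
    rintro (_ | ⟨p, t⟩) h
    · rfl
    · exact (hne p t h.symm).elim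
  | cons p t ih =>
    rintro (_ | ⟨p', t'⟩) h
    · exact (hne p t h).elim
    · obtain ⟨h1, h2⟩ := dyckWord_append_unique (p.2.2.notStartsNeg_posWord _)
        (p'.2.2.notStartsNeg_posWord _) h
      have h3 : p.2 = p'.2 := Subtype.ext (p.2.2.posWord_unique p'.2.2 h2)
      rw [h3] at h2
      rw [ih (List.append_cancel_left h2), Prod.ext h1 h3]

end DyckWords

/-! ### Generating functions of loops, Dyck words and chains -/

section GeneratingFunctions

open scoped ENNReal

variable {G : DirectedGraph V E} {v : V}

open Classical in
/-- The generating function of the paths from `u` that end at their first visit to `v`. -/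
noncomputable def firstHitSum (G : DirectedGraph V E) (v u : V) (z : ℝ≥0∞) : ℝ≥0∞ :=
  ∑' l : List E, if G.FirstHit v l u then z ^ l.length else 0

theorem tsum_loop (z : ℝ≥0∞) : ∑' c : G.Loop v, z ^ c.1.length = G.firstHitSum v v z := by
  classical
  rw [firstHitSum]
  exact (tsum_subtype {l : List E | G.FirstHit v l v} fun l => z ^ l.length).trans
    (tsum_congr fun l => by simp [Set.indicator_apply])

/-- Each bracket pair uses its loop twice, whence the argument z². In `ℝ≥0∞` the identity needs no
convergence. -/
theorem tsum_dyckWord (z : ℝ≥0∞) :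
    ∑' d : DyckTree (G.Loop v), z ^ (dyckWord d).length =
      1 + G.firstHitSum v v (z ^ 2) * (∑' d : DyckTree (G.Loop v), z ^ (dyckWord d).length) ^ 2 := by
  conv_lhs => rw [DyckTree.tsum_eq]
  congr 1
  · simp [dyckWord]
  have : ∀ (c : G.Loop v) (a b : DyckTree (G.Loop v)),
      z ^ (dyckWord (.node c a b)).length =
        (z ^ 2) ^ c.1.length * (z ^ (dyckWord a).length * z ^ (dyckWord b).length) := by
    intro c a b
    rw [dyckWord, List.length_append, List.length_append, List.length_append, length_negWord,
      length_posWord]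
    ring
  simp_rw [this, ENNReal.tsum_mul_left, ENNReal.tsum_mul_right]
  rw [tsum_loop, sq (∑' d : DyckTree (G.Loop v), z ^ (dyckWord d).length)]

theorem tsum_chainWord (z : ℝ≥0∞) :
    ∑' t : List (DyckTree (G.Loop v) × G.Loop v), z ^ (chainWord t).length =
      1 + (∑' d : DyckTree (G.Loop v), z ^ (dyckWord d).length) * G.firstHitSum v v z *
        ∑' t : List (DyckTree (G.Loop v) × G.Loop v), z ^ (chainWord t).length := by
  conv_lhs => rw [ENNReal.tsum_list]
  congr 1
  · simp [chainWord]
  have : ∀ (p : DyckTree (G.Loop v) × G.Loop v) t, z ^ (chainWord (p :: t)).length =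
      z ^ (dyckWord p.1).length * z ^ p.2.1.length * z ^ (chainWord t).length := by
    intro p t
    rw [chainWord, List.length_append, List.length_append, length_posWord]
    ring
  simp_rw [this, ENNReal.tsum_mul_left, ENNReal.tsum_mul_right]
  rw [ENNReal.tsum_prod (f := fun (d : DyckTree (G.Loop v)) (c : G.Loop v) =>
    z ^ (dyckWord d).length * z ^ c.1.length)]
  simp_rw [ENNReal.tsum_mul_left, ENNReal.tsum_mul_right]
  rw [tsum_loop]

theorem turnShift_nonempty (h : ∃ l, G.FirstHit v l v) : (G.turnShift v).Nonempty := by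
  obtain ⟨l, hl⟩ := h
  have h2 : G.Transfers v (posWord l) l.reverse [] := fun q => hl.run_posWord q
  have h3 : G.GoodWord v (posWord l) := ⟨hl.turnWord_posWord, _, h2⟩
  exact ⟨_, h3.periodicSeq_mem (by simpa [posWord] using hl.ne_nil)⟩

theorem chainWord_get_mem (h : ∃ l, G.FirstHit v l v)
    (t : List (DyckTree (G.Loop v) × G.Loop v)) :
    (chainWord t).get ∈ languageOfLength (G.turnShift v) (chainWord t).length := by
  -- The empty word has no periodic extension; it lies in the language because the shift has a
  -- point.
  by_cases ht : chainWord t = []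
  · obtain ⟨x, hx⟩ := turnShift_nonempty h
    exact ⟨x, hx, 0, fun k => absurd k.2 (by simp [ht])⟩
  · exact (goodWord_chainWord t).get_mem_language ht

theorem tsum_chainWord_le [Finite E] (h : ∃ l, G.FirstHit v l v) (z : ℝ≥0∞) :
    ∑' t : List (DyckTree (G.Loop v) × G.Loop v), z ^ (chainWord t).length ≤
      ∑' n : ℕ, ((languageOfLength (G.turnShift v) n).ncard : ℝ≥0∞) * z ^ n := by
  let F : List (DyckTree (G.Loop v) × G.Loop v) →
      Σ n : ℕ, (languageOfLength (G.turnShift v) n : Set (Fin n → Letter E)) :=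
    fun t => ⟨(chainWord t).length, (chainWord t).get, chainWord_get_mem h t⟩
  have hF : Function.Injective F := by
    intro t t' htt
    apply chainWord_injective
    have h1 : (⟨(F t).1, (F t).2.1⟩ : Σ n, Fin n → Letter E) = ⟨(F t').1, (F t').2.1⟩ := by
      rw [htt]
    have h2 := congrArg (fun p : Σ n, Fin n → Letter E => List.ofFn p.2) h1
    simpa [F] using h2
  refine (ENNReal.tsum_comp_le_tsum_of_injective hF fun p => z ^ p.1).trans ?_
  rw [ENNReal.tsum_sigma']
  refine ENNReal.tsum_le_tsum fun n => ?_
  have := Fintype.ofFinite (languageOfLength (G.turnShift v) n)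
  rw [tsum_fintype]
  simp only []
  rw [Finset.sum_const, Finset.card_univ, nsmul_eq_mul, ← Nat.card_eq_fintype_card,
    Nat.card_coe_set_eq]

/-- Finiteness of S = 1 + DfS forces Df < 1, so f < 1/D. Dividing D = 1 + f(z²)D² by D² gives (1/D -
1/2)² = 1/4 - f(z²), and 1/D ≤ 1/2 + √(1/4 - f(z²)) whichever root D is. All series are shown finite
before `toReal` is applied, as it sends ∞ to 0. -/
theorem firstHitSum_lt_of_tsum_ne_top [Finite E] (h : ∃ l, G.FirstHit v l v) {z : ℝ≥0∞}
    (hz : z ≠ 0)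
    (hsum : ∑' n : ℕ, ((languageOfLength (G.turnShift v) n).ncard : ℝ≥0∞) * z ^ n ≠ ∞) :
    (G.firstHitSum v v z).toReal < 1 / 2 + √(1 / 4 - (G.firstHitSum v v (z ^ 2)).toReal) := by
  have hS := ne_top_of_le_ne_top hsum (tsum_chainWord_le h z)
  have hSe := tsum_chainWord (G := G) (v := v) z
  have hDe := tsum_dyckWord (G := G) (v := v) z
  set S := ∑' t : List (DyckTree (G.Loop v) × G.Loop v), z ^ (chainWord t).length
  set D := ∑' d : DyckTree (G.Loop v), z ^ (dyckWord d).length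
  set f := G.firstHitSum v v z with hf
  set f2 := G.firstHitSum v v (z ^ 2)
  have hS1 : 1 ≤ S := by rw [hSe]; exact le_self_add
  have hD1 : 1 ≤ D := by rw [hDe]; exact le_self_add
  have hf0 : f ≠ 0 := by
    obtain ⟨l, hl⟩ := h
    rw [hf, ← tsum_loop]
    intro h0
    exact pow_ne_zero _ hz (ENNReal.tsum_eq_zero.1 h0 ⟨l, hl⟩)
  have hDfS : D * f * S ≤ S := by
    conv_rhs => rw [hSe]
    exact le_add_self
  have hDf : D * f ≠ ∞ :=
    ne_top_of_le_ne_top hS ((le_mul_of_one_le_right' hS1).trans hDfS)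
  have hD : D ≠ ∞ := fun h0 => hDf (by rw [h0, ENNReal.top_mul hf0])
  have hfT : f ≠ ∞ := ne_top_of_le_ne_top hDf (le_mul_of_one_le_left' hD1)
  have hf2T : f2 ≠ ∞ := by
    refine ne_top_of_le_ne_top hD ?_
    calc f2 ≤ f2 * D ^ 2 := le_mul_of_one_le_right' (one_le_pow₀ hD1)
      _ ≤ 1 + f2 * D ^ 2 := le_add_self
      _ = D := hDe.symm
  have e1 : S.toReal = 1 + D.toReal * f.toReal * S.toReal := by
    conv_lhs => rw [hSe]
    rw [ENNReal.toReal_add ENNReal.one_ne_top (ENNReal.mul_ne_top hDf hS)]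
    simp
  have e2 : D.toReal = 1 + f2.toReal * D.toReal ^ 2 := by
    conv_lhs => rw [hDe]
    rw [ENNReal.toReal_add ENNReal.one_ne_top (ENNReal.mul_ne_top hf2T (ENNReal.pow_ne_top hD))]
    simp
  have e3 : 1 ≤ D.toReal := by
    rw [← ENNReal.toReal_one]; exact ENNReal.toReal_mono hD hD1
  have e4 : 1 ≤ S.toReal := by
    rw [← ENNReal.toReal_one]; exact ENNReal.toReal_mono hS hS1
  have e5 : D.toReal * f.toReal < 1 := by
    by_contra! hcon
    nlinarith
  have hDpos : 0 < D.toReal := by linarith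
  have e6 : f.toReal < 1 / D.toReal := by rwa [lt_div_iff₀ hDpos, mul_comm]
  have e7 : 1 / 4 - f2.toReal = (1 / D.toReal - 1 / 2) ^ 2 := by
    have : f2.toReal = (D.toReal - 1) / D.toReal ^ 2 := by
      rw [eq_div_iff (by positivity)]; linarith
    rw [this]; field_simp; ring
  have e8 : 1 / D.toReal - 1 / 2 ≤ √(1 / 4 - f2.toReal) := by
    rw [e7, Real.sqrt_sq_eq_abs]; exact le_abs_self _
  linarith

theorem firstHitSum_eq [Fintype E] [DecidableEq V] (u : V) (z : ℝ≥0∞) :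
    G.firstHitSum v u z =
      z * ∑ e : E, if G.s e = u then (if G.r e = v then 1 else G.firstHitSum v (G.r e) z) else 0 := by
  classical
  conv_lhs => rw [firstHitSum, ENNReal.tsum_list]
  rw [if_neg (by simp [FirstHit]), zero_add, tsum_fintype, Finset.mul_sum]
  refine Finset.sum_congr rfl fun e _ => ?_
  by_cases hs : G.s e = u
  · by_cases hr : G.r e = v
    · rw [if_pos hs, if_pos hr, tsum_eq_single []]
      · simp [FirstHit, hs, hr]
      · intro l hl
        simp [FirstHit, hr, hl]
    · rw [if_pos hs, if_neg hr, firstHitSum, ← ENNReal.tsum_mul_left]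
      refine tsum_congr fun l => ?_
      by_cases hl : G.FirstHit v l (G.r e)
      · simp [FirstHit, hs, hr, hl, pow_succ']
      · simp [FirstHit, hr, hl]
  · simp [FirstHit, hs]

end GeneratingFunctions

end DirectedGraph

/-! ### Spectral radius, powers and principal minors of matrices -/

namespace Matrix

open scoped ENNReal NNReal

attribute [local instance] Matrix.linftyOpNormedRing Matrix.linftyOpNormedAlgebra

variable {V : Type*} [Fintype V] [DecidableEq V]

theorem exists_norm_eigenvalue_eq_spectralRadius [Nonempty V] (M : Matrix V V ℂ) :
    ∃ (μ : ℂ) (y : V → ℂ), y ≠ 0 ∧ M *ᵥ y = μ • y ∧ ‖μ‖ = (spectralRadius ℂ M).toReal := by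
  obtain ⟨μ, hμ, hr⟩ := spectrum.exists_nnnorm_eq_spectralRadius M
  rw [spectrum.mem_iff, Matrix.isUnit_iff_isUnit_det, isUnit_iff_ne_zero, not_not,
    ← Matrix.exists_mulVec_eq_zero_iff] at hμ
  obtain ⟨y, hy, hy'⟩ := hμ
  refine ⟨μ, y, hy, ?_, by rw [← hr]; simp⟩
  rw [Matrix.sub_mulVec, sub_eq_zero, Algebra.algebraMap_eq_smul_one, Matrix.smul_mulVec,
    Matrix.one_mulVec] at hy'
  exact hy'.symm

theorem spectralRadius_ne_top (M : Matrix V V ℂ) : spectralRadius ℂ M ≠ ∞ := by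
  cases isEmpty_or_nonempty V
  · have : Subsingleton (Matrix V V ℂ) := inferInstance
    simp [spectralRadius, spectrum.of_subsingleton]
  · exact ((spectrum.spectralRadius_le_nnnorm M).trans_lt ENNReal.coe_lt_top).ne

/-- I - zM = z(z⁻¹ - M), and z⁻¹ exceeds the spectral radius. -/
theorem det_one_sub_smul_ne_zero (M : Matrix V V ℂ) {z : ℝ} (hz : 0 < z)
    (h : z * (spectralRadius ℂ M).toReal < 1) : (1 - (z : ℂ) • M).det ≠ 0 := by
  have hzc : (z : ℂ) ≠ 0 := by exact_mod_cast hz.ne'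
  have h1 : (z : ℂ)⁻¹ ∈ resolventSet ℂ M := by
    apply spectrum.mem_resolventSet_of_spectralRadius_lt
    rw [← ENNReal.toReal_lt_toReal (spectralRadius_ne_top M) ENNReal.coe_ne_top]
    simp only [ENNReal.coe_toReal, coe_nnnorm, norm_inv, Complex.norm_real, Real.norm_eq_abs,
      abs_of_pos hz]
    rwa [← one_div, lt_div_iff₀ hz, mul_comm]
  have h2 : (1 - (z : ℂ) • M) = (z : ℂ) • (algebraMap ℂ _ (z : ℂ)⁻¹ - M) := by
    rw [smul_sub, Algebra.algebraMap_eq_smul_one, smul_smul, mul_inv_cancel₀ hzc, one_smul]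
  rw [h2, Matrix.det_smul]
  refine mul_ne_zero (pow_ne_zero _ hzc) ?_
  rw [← isUnit_iff_ne_zero, ← Matrix.isUnit_iff_isUnit_det]
  exact h1

theorem norm_entry_le_linfty_opNorm (M : Matrix V V ℂ) (i j : V) : ‖M i j‖ ≤ ‖M‖ := by
  have h : ‖M i j‖₊ ≤ ‖M‖₊ := by
    rw [Matrix.linfty_opNNNorm_def]
    exact (Finset.single_le_sum (f := fun j => ‖M i j‖₊) (fun _ _ => zero_le) (Finset.mem_univ j)).trans
      (Finset.le_sup (f := fun i => ∑ j, ‖M i j‖₊) (Finset.mem_univ i))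
  exact h

/-- By Gelfand's formula ‖Mⁿ‖ < rⁿ eventually, for any r strictly between the spectral radius and
1/z; a geometric series of ratio zr < 1 dominates. -/
theorem summable_pow_entry (A : Matrix V V ℝ) {z : ℝ} (hz : 0 < z)
    (h : z * (spectralRadius ℂ (A.map (algebraMap ℝ ℂ))).toReal < 1) (i j : V) :
    Summable fun n : ℕ => z ^ n * (A ^ n) i j := by
  set M := A.map (algebraMap ℝ ℂ) with hM
  have hR := spectralRadius_ne_top M
  have h1 : (spectralRadius ℂ M).toReal < z⁻¹ := by
    rw [← one_div, lt_div_iff₀ hz, mul_comm]; exact h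
  obtain ⟨r, hr1, hr2⟩ := exists_between h1
  have hr0 : 0 ≤ r := ENNReal.toReal_nonneg.trans hr1.le
  have h2 : spectralRadius ℂ M < ENNReal.ofReal r := by
    rwa [ENNReal.lt_ofReal_iff_toReal_lt hR]
  have h3 := (spectrum.pow_norm_pow_one_div_tendsto_nhds_spectralRadius M).eventually_lt_const h2
  have hzr : z * r < 1 := by
    have := mul_lt_mul_of_pos_left hr2 hz
    rwa [mul_inv_cancel₀ hz.ne'] at this
  refine Summable.of_norm_bounded_eventually_nat (g := fun n => (z * r) ^ n)
    (summable_geometric_of_lt_one (by positivity) hzr) ?_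
  filter_upwards [h3, eventually_gt_atTop 0] with n hn hn0
  have h4 : ‖M ^ n‖ ^ (1 / n : ℝ) < r := ENNReal.ofReal_lt_ofReal_iff'.1 hn |>.1
  have h5 : ‖M ^ n‖ ≤ r ^ n := by
    have := pow_le_pow_left₀ (by positivity) h4.le n
    rwa [one_div, Real.rpow_inv_natCast_pow (norm_nonneg _) hn0.ne'] at this
  have h6 : ‖(A ^ n) i j‖ ≤ r ^ n := by
    refine le_trans ?_ h5
    refine le_trans (le_of_eq ?_) (norm_entry_le_linfty_opNorm (M ^ n) i j)
    have h7 : M ^ n = (A ^ n).map (algebraMap ℝ ℂ) := by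
      have := map_pow (algebraMap ℝ ℂ).mapMatrix A n
      exact this.symm
    rw [h7, Matrix.map_apply]
    simp
  rw [norm_mul, norm_pow, Real.norm_of_nonneg hz.le, mul_pow]
  exact mul_le_mul_of_nonneg_left h6 (by positivity)

theorem det_updateRow_single_one {R : Type*} [CommRing R] (M : Matrix V V R) (v : V) :
    (M.updateRow v (Pi.single v 1)).det =
      (M.submatrix (Subtype.val : {u : V // u ≠ v} → V) Subtype.val).det := by
  rw [Matrix.twoBlockTriangular_det _ (fun u => u ≠ v)]
  · let _ : Unique {u : V // ¬ u ≠ v} :=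
      { default := ⟨v, by simp⟩, uniq := fun u => Subtype.ext (not_not.1 u.2) }
    have h1 : (Matrix.toSquareBlockProp (M.updateRow v (Pi.single v 1))
        fun u => ¬ u ≠ v).det = 1 := by
      rw [Matrix.det_unique]
      change M.updateRow v (Pi.single v 1) v v = 1
      simp
    rw [h1, mul_one]
    congr 1
    ext i j
    exact congrFun (Matrix.updateRow_ne i.2) _
  · intro i hi j hj
    obtain rfl := not_not.1 hi
    simp [hj]

/-- If `M h = c e_v` and `h_v = 1`, then `det M` is `c` times the principal minor at `v`. -/
theorem det_eq_minor_mul {R : Type*} [CommRing R] (M : Matrix V V R) (v : V) (h : V → R) (c : R)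
    (hv : h v = 1) (hM : M *ᵥ h = Pi.single v c) :
    M.det = (M.updateRow v (Pi.single v 1)).det * c := by
  -- Read at the coordinate v, this is the claim: the (v, v) entry of the adjugate is the principal
  -- minor.
  have h1 : M.adjugate *ᵥ (M *ᵥ h) = M.det • h := by
    rw [Matrix.mulVec_mulVec, Matrix.adjugate_mul, Matrix.smul_mulVec, Matrix.one_mulVec]
  have h2 := congrFun h1 v
  rw [hM, Matrix.mulVec_single, Pi.smul_apply (M.det), hv, smul_eq_mul, mul_one] at h2
  rw [← h2, ← Matrix.adjugate_apply]
  simp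

end Matrix

namespace DirectedGraph

open Matrix

variable {V E : Type*}

/-! ### Existence of first-hit paths -/

section Paths

variable {G : DirectedGraph V E} {v : V}

theorem exists_firstHit_of_ne (hG : G.StronglyConnected) {u : V} (hu : u ≠ v) :
    ∃ l, G.FirstHit v l u := by
  have := hG u v
  induction this using Relation.ReflTransGen.head_induction_on with
  | refl => exact (hu rfl).elim
  | head hab _ ih =>
    obtain ⟨e, rfl, rfl⟩ := hab
    by_cases hb : G.r e = v
    · exact ⟨[e], rfl, .inl ⟨hb, rfl⟩⟩
    · obtain ⟨l, hl⟩ := ih hb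
      exact ⟨e :: l, rfl, .inr ⟨hb, hl⟩⟩

theorem exists_source_eq [Nonempty E] (hG : G.StronglyConnected) (u : V) : ∃ e, G.s e = u := by
  obtain ⟨e⟩ := ‹Nonempty E›
  rcases (hG u (G.s e)).cases_head with h | ⟨b, ⟨e', h, -⟩, -⟩
  · exact ⟨e, h.symm⟩
  · exact ⟨e', h⟩

theorem exists_firstHit [Nonempty E] (hG : G.StronglyConnected) (u : V) :
    ∃ l, G.FirstHit v l u := by
  by_cases hu : u = v
  · obtain ⟨e, he⟩ := exists_source_eq hG u
    by_cases hr : G.r e = v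
    · exact ⟨[e], he, .inl ⟨hr, rfl⟩⟩
    · obtain ⟨l, hl⟩ := exists_firstHit_of_ne hG hr
      exact ⟨e :: l, he, .inr ⟨hr, hl⟩⟩
  · exact exists_firstHit_of_ne hG hu

end Paths

/-! ### The adjacency operator and a maximum principle -/

section AdjacencySums

variable [DecidableEq V] [Fintype E]

/-- The sum of `h (r e)` over the edges `e` that leave `u`. -/
def outSum {R : Type*} [AddCommMonoid R] (G : DirectedGraph V E) (h : V → R) (u : V) : R :=
  ∑ e : E, if G.s e = u then h (G.r e) else 0

theorem adjacencyMatrix_map_mulVec [Fintype V] (G : DirectedGraph V E) {R : Type*} [CommRing R] [Algebra ℝ R]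
    (h : V → R) : (G.adjacencyMatrix.map (algebraMap ℝ R)) *ᵥ h = G.outSum h := by
  classical
  funext u
  simp only [Matrix.mulVec, dotProduct, Matrix.map_apply, adjacencyMatrix, Matrix.of_apply,
    map_natCast, outSum]
  have : ∀ w, (Nat.card {e : E // G.s e = u ∧ G.r e = w} : R) * h w =
      ∑ e : E, if G.r e = w then (if G.s e = u then h (G.r e) else 0) else 0 := by
    intro w
    rw [Nat.card_eq_fintype_card, Fintype.card_subtype, Finset.card_filter, Nat.cast_sum,
      Finset.sum_mul]
    refine Finset.sum_congr rfl fun e _ => ?_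
    by_cases h1 : G.s e = u <;> by_cases h2 : G.r e = w <;> simp [h1, h2]
  simp_rw [this]
  rw [Finset.sum_comm]
  simp

theorem adjacencyMatrix_mulVec [Fintype V] (G : DirectedGraph V E) (h : V → ℝ) :
    G.adjacencyMatrix *ᵥ h = G.outSum h := by
  rw [← adjacencyMatrix_map_mulVec]
  congr 1

theorem outSum_mono (G : DirectedGraph V E) {h h' : V → ℝ} (hh : ∀ x, h x ≤ h' x) (u : V) :
    G.outSum h u ≤ G.outSum h' u := by
  refine Finset.sum_le_sum fun e _ => ?_
  split_ifs
  · exact hh _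
  · exact le_rfl

theorem outSum_const_mul (G : DirectedGraph V E) (c : ℝ) (h : V → ℝ) (u : V) :
    G.outSum (fun x => c * h x) u = c * G.outSum h u := by
  simp [outSum, Finset.mul_sum]

theorem le_outSum (G : DirectedGraph V E) {h : V → ℝ} (hh : ∀ x, 0 ≤ h x) (e : E) :
    h (G.r e) ≤ G.outSum h (G.s e) := by
  refine le_trans (by simp) (Finset.single_le_sum
    (f := fun e' => if G.s e' = G.s e then h (G.r e') else 0) (fun e' _ => ?_) (Finset.mem_univ e))
  split_ifs
  · exact hh _
  · exact le_rfl

/-- Maximum principle: a nonnegative function that is subharmonic off `v` is at most its value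
at `v` times the positive function `h` that is harmonic off `v` with `h v = 1`. -/
theorem le_mul_of_subharmonic [Finite V] {G : DirectedGraph V E} (hG : G.StronglyConnected) {v : V} {z : ℝ}
    (hz : 0 < z) {y h : V → ℝ} (hh : ∀ x, 0 < h x) (hhv : h v = 1)
    (hy : ∀ x, x ≠ v → y x ≤ z * G.outSum y x) (hharm : ∀ x, x ≠ v → h x = z * G.outSum h x)
    (x : V) : y x ≤ y v * h x := by
  have : Nonempty V := ⟨v⟩
  obtain ⟨x₀, hx₀⟩ := Finite.exists_max fun x => y x / h x
  set M := y x₀ / h x₀ with hM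
  let g : V → ℝ := fun x => M * h x - y x
  have hg : ∀ x, 0 ≤ g x := fun x => by
    have := (div_le_iff₀ (hh x)).1 (hx₀ x)
    simpa [g] using this
  have hgo : ∀ x, G.outSum g x = M * G.outSum h x - G.outSum y x := by
    intro x
    rw [← outSum_const_mul]
    simp only [outSum, g]
    rw [← Finset.sum_sub_distrib]
    refine Finset.sum_congr rfl fun e _ => ?_
    split_ifs <;> simp
  have hg0 : g x₀ = 0 := by simp [g, hM, (hh x₀).ne']
  -- Here M is the maximum of y / h, and g = M h - y is nonnegative, superharmonic off v and zero at
  -- a maximiser. A zero of g off v passes to all out-neighbours, hence along a path to v, where h =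
  -- 1 gives M = y v.
  have key : ∀ a, Relation.ReflTransGen (fun a b => ∃ e : E, G.s e = a ∧ G.r e = b) a v →
      g a = 0 → g v = 0 := by
    intro a hp hga
    induction hp using Relation.ReflTransGen.head_induction_on with
    | refl => exact hga
    | head hab _ ih =>
      rename_i a b _
      obtain ⟨e, rfl, rfl⟩ := hab
      by_cases ha : G.s e = v
      · exact ha ▸ hga
      · apply ih
        have h1 := le_outSum G hg e
        rw [hgo] at h1
        have h2 := hy _ ha
        have h3 := hharm _ ha
        have h4 : z * g (G.r e) ≤ g (G.s e) := by
          have := mul_le_mul_of_nonneg_left h1 hz.le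
          simp only [g] at this ⊢
          rw [h3]
          nlinarith
        rw [hga] at h4
        have h5 := hg (G.r e)
        nlinarith
  have h1 : M = y v := by simpa [g, hhv, sub_eq_zero] using key x₀ (hG x₀ v) hg0
  have := hg x
  simp only [g, h1] at this
  linarith

end AdjacencySums

end DirectedGraph

open Polynomial in
/-- A real polynomial that is positive at `0` and has no zero in `(0, z]` is positive at `z`. -/
theorem Polynomial.eval_pos_of_ne_zero {P : ℝ[X]} (h0 : 0 < P.eval 0) {z : ℝ} (hz : 0 ≤ z)
    (h : ∀ x, 0 < x → x ≤ z → P.eval x ≠ 0) : 0 < P.eval z := by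
  by_contra! hcon
  obtain ⟨x, hx, hx0⟩ := intermediate_value_Icc' hz P.continuous.continuousOn ⟨hcon, h0.le⟩
  rcases hx.1.eq_or_lt with rfl | hpos
  · exact h0.ne' hx0
  · exact h x hpos hx.2 hx0

namespace DirectedGraph

open Matrix
open scoped ENNReal

variable {V E : Type*}

/-! ### Values of the polynomials p and p_v -/

section Polynomials

variable [Fintype V] [DecidableEq V]

theorem detPoly_eval (G : DirectedGraph V E) (z : ℝ) :
    G.detPoly.eval z = (1 - z • G.adjacencyMatrix).det := by
  rw [detPoly, ← Polynomial.coe_evalRingHom, RingHom.map_det]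
  congr 1
  ext i j
  by_cases h : i = j <;> simp [h] <;> ring

theorem minorPoly_eval (G : DirectedGraph V E) (v : V) (z : ℝ) :
    (G.minorPoly v).eval z =
      ((1 - z • G.adjacencyMatrix).updateRow v (Pi.single v 1)).det := by
  rw [Matrix.det_updateRow_single_one, minorPoly, ← Polynomial.coe_evalRingHom, RingHom.map_det]
  congr 1
  ext i j
  by_cases h : (i : V) = j <;> simp [h] <;> ring

theorem detPoly_eval_zero (G : DirectedGraph V E) : G.detPoly.eval 0 = 1 := by
  simp [detPoly_eval]

theorem minorPoly_eval_zero (G : DirectedGraph V E) (v : V) : (G.minorPoly v).eval 0 = 1 := by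
  rw [minorPoly_eval, Matrix.det_updateRow_single_one]
  simp [Matrix.submatrix_one _ Subtype.val_injective]

theorem perronEigenvalue_nonneg (G : DirectedGraph V E) : 0 ≤ G.perronEigenvalue :=
  ENNReal.toReal_nonneg

theorem detPoly_eval_pos {G : DirectedGraph V E} {z : ℝ} (hz : 0 < z) (h : z * G.perronEigenvalue < 1) :
    0 < G.detPoly.eval z := by
  refine Polynomial.eval_pos_of_ne_zero (by simp [detPoly_eval_zero]) hz.le fun x hx hxz => ?_
  have hx1 : x * G.perronEigenvalue < 1 :=
    (mul_le_mul_of_nonneg_right hxz (perronEigenvalue_nonneg G)).trans_lt h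
  have h1 := Matrix.det_one_sub_smul_ne_zero _ hx hx1
  rw [detPoly_eval]
  intro h0
  apply h1
  have h2 := congrArg (algebraMap ℝ ℂ) h0
  rw [RingHom.map_det, map_zero] at h2
  rw [← h2]
  congr 1
  ext i j
  by_cases hij : i = j <;> simp [hij]

end Polynomials

/-! ### First-hit series: convexity, finiteness and the renewal identity -/

section FirstHitSums

variable {G : DirectedGraph V E} {v : V}

theorem firstHitSum_mono {z w : ℝ≥0∞} (h : z ≤ w) (u : V) :
    G.firstHitSum v u z ≤ G.firstHitSum v u w := by
  refine ENNReal.tsum_le_tsum fun l => ?_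
  split_ifs
  · gcongr
  · exact le_rfl

theorem firstHitSum_ne_zero [Nonempty E] (hG : G.StronglyConnected) {z : ℝ≥0∞} (hz : z ≠ 0)
    (u : V) : G.firstHitSum v u z ≠ 0 := by
  classical
  obtain ⟨l, hl⟩ := exists_firstHit (v := v) hG u
  intro h
  have := ENNReal.tsum_eq_zero.1 h l
  rw [if_pos hl] at this
  exact pow_ne_zero _ hz this

theorem one_le_firstHitSum_one [Nonempty E] (hG : G.StronglyConnected) (u : V) :
    1 ≤ G.firstHitSum v u 1 := by
  classical
  obtain ⟨l, hl⟩ := exists_firstHit (v := v) hG u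
  refine le_trans ?_ (ENNReal.le_tsum l)
  rw [if_pos hl, one_pow]

/-- Convexity holds term by term, since every power is convex on the nonnegative reals. -/
theorem firstHitSum_add_le (u : V) {a b x y : ℝ} (ha : 0 ≤ a) (hb : 0 ≤ b) (hab : a + b = 1)
    (hx : 0 ≤ x) (hy : 0 ≤ y) :
    G.firstHitSum v u (.ofReal (a * x + b * y)) ≤
      .ofReal a * G.firstHitSum v u (.ofReal x) + .ofReal b * G.firstHitSum v u (.ofReal y) := by
  classical
  simp only [firstHitSum]
  rw [← ENNReal.tsum_mul_left, ← ENNReal.tsum_mul_left, ← ENNReal.tsum_add]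
  refine ENNReal.tsum_le_tsum fun l => ?_
  split_ifs
  · rw [← ENNReal.ofReal_pow (by positivity), ← ENNReal.ofReal_pow hx, ← ENNReal.ofReal_pow hy,
      ← ENNReal.ofReal_mul ha, ← ENNReal.ofReal_mul hb,
      ← ENNReal.ofReal_add (by positivity) (by positivity)]
    exact ENNReal.ofReal_le_ofReal ((convexOn_pow l.length).2 hx hy ha hb hab)
  · simp

/-- The generating function is left continuous. -/
theorem firstHitSum_le_of_forall_lt {u : V} {z : ℝ} (hz : 0 < z) {c : ℝ≥0∞}
    (h : ∀ w, 0 < w → w < z → G.firstHitSum v u (.ofReal w) ≤ c) :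
    G.firstHitSum v u (.ofReal z) ≤ c := by
  classical
  rw [firstHitSum, ENNReal.tsum_eq_iSup_sum]
  refine iSup_le fun s => ?_
  have hcont : Continuous fun w : ℝ =>
      ∑ l ∈ s, if G.FirstHit v l u then (ENNReal.ofReal w) ^ l.length else 0 := by
    refine continuous_finsetSum _ fun l _ => ?_
    split_ifs
    · exact (ENNReal.continuous_pow _).comp ENNReal.continuous_ofReal
    · exact continuous_const
  refine le_of_tendsto (hcont.tendsto z |>.mono_left (nhdsWithin_le_nhds (s := Set.Iio z))) ?_
  filter_upwards [self_mem_nhdsWithin, nhdsWithin_le_nhds (lt_mem_nhds hz)] with w hw hw0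
  exact (ENNReal.sum_le_tsum s).trans (h w hw0 hw)

/-- The generating function of the first-return loops at `v`. -/
noncomputable def loopSum (G : DirectedGraph V E) (v : V) (z : ℝ) : ℝ :=
  (G.firstHitSum v v (.ofReal z)).toReal

/-- The real values of the generating functions, with `1` at `v`. -/
noncomputable def hitVec [DecidableEq V] (G : DirectedGraph V E) (v : V) (z : ℝ) (x : V) : ℝ :=
  if x = v then 1 else (G.firstHitSum v x (.ofReal z)).toReal

theorem hitVec_pos [DecidableEq V] [Nonempty E] (hG : G.StronglyConnected) {z : ℝ} (hz : 0 < z)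
    (h : ∀ u, G.firstHitSum v u (.ofReal z) ≠ ∞) (x : V) : 0 < G.hitVec v z x := by
  rw [hitVec]
  split_ifs
  · exact one_pos
  · exact ENNReal.toReal_pos (firstHitSum_ne_zero hG (by simpa using hz) x) (h x)

theorem hitVec_self [DecidableEq V] (z : ℝ) : G.hitVec v z v = 1 := if_pos rfl

variable [DecidableEq V] [Fintype E]

/-- Any solution of the first-step inequality dominates the generating functions. -/
theorem firstHitSum_le_of_supersolution {z : ℝ≥0∞} {Y : V → ℝ≥0∞}
    (hY : ∀ u, z * G.outSum (fun x => if x = v then 1 else Y x) u ≤ Y u) (u : V) :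
    G.firstHitSum v u z ≤ Y u := by
  classical
  -- Truncation to paths of length at most N permits induction by first-step decomposition; every
  -- finite partial sum is covered by some N.
  have key : ∀ (N : ℕ) (u : V),
      ∑' l : List E, (if G.FirstHit v l u ∧ l.length ≤ N then z ^ l.length else 0) ≤ Y u := by
    intro N
    induction N with
    | zero =>
      intro u
      rw [ENNReal.tsum_eq_zero.2]
      · exact zero_le
      · rintro (_ | ⟨e, l⟩) <;> simp [FirstHit]
    | succ N ih =>
      intro u
      refine le_trans ?_ (hY u)
      rw [ENNReal.tsum_list, if_neg (by simp [FirstHit]), zero_add, tsum_fintype, outSum,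
        Finset.mul_sum]
      refine Finset.sum_le_sum fun e _ => ?_
      by_cases hs : G.s e = u
      · by_cases hr : G.r e = v
        · rw [if_pos hs, if_pos hr, tsum_eq_single []]
          · simp [FirstHit, hs, hr]
          · intro l hl
            simp [FirstHit, hr, hl]
        · rw [if_pos hs, if_neg hr]
          refine le_trans (le_of_eq ?_) (mul_le_mul_right (ih (G.r e)) z)
          rw [← ENNReal.tsum_mul_left]
          refine tsum_congr fun l => ?_
          by_cases hl : G.FirstHit v l (G.r e)
          · simp [FirstHit, hs, hr, hl, pow_succ']
          · simp [FirstHit, hr, hl]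
      · simp [FirstHit, hs]
  rw [firstHitSum, ENNReal.tsum_eq_iSup_sum]
  refine iSup_le fun s => ?_
  refine le_trans ?_ (key (s.sup List.length) u)
  refine le_trans (Finset.sum_le_sum fun l hl => ?_) (ENNReal.sum_le_tsum s)
  have hlen : l.length ≤ s.sup List.length := Finset.le_sup (f := List.length) hl
  by_cases h : G.FirstHit v l u <;> simp [h, hlen]

/-- Finiteness travels along edges out of v: the series at the source of an edge is at least z times
the series at its range, if that range is not v. -/
theorem firstHitSum_ne_top_of_loop (hG : G.StronglyConnected) {z : ℝ≥0∞} (hz : z ≠ 0)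
    (h : G.firstHitSum v v z ≠ ∞) (u : V) : G.firstHitSum v u z ≠ ∞ := by
  have hp := hG v u
  induction hp with
  | refl => exact h
  | tail _ hbc ih =>
    obtain ⟨e, rfl, rfl⟩ := hbc
    by_cases hr : G.r e = v
    · rwa [hr]
    intro htop
    apply ih
    rw [firstHitSum_eq, ENNReal.mul_eq_top]
    refine .inl ⟨hz, ?_⟩
    rw [ENNReal.sum_eq_top]
    exact ⟨e, Finset.mem_univ e, by rw [if_pos rfl, if_neg hr, htop]⟩

theorem toReal_firstHitSum_eq {z : ℝ} (hz : 0 < z)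
    (h : ∀ u, G.firstHitSum v u (.ofReal z) ≠ ∞) (u : V) :
    (G.firstHitSum v u (.ofReal z)).toReal = z * G.outSum (G.hitVec v z) u := by
  rw [firstHitSum_eq, ENNReal.toReal_mul, ENNReal.toReal_ofReal hz.le, ENNReal.toReal_sum]
  · congr 1
    refine Finset.sum_congr rfl fun e _ => ?_
    rw [hitVec]
    split_ifs <;> simp
  · intro e _
    split_ifs
    · simp
    · exact h _
    · simp

theorem hitVec_of_ne {z : ℝ} (hz : 0 < z) (h : ∀ u, G.firstHitSum v u (.ofReal z) ≠ ∞)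
    (x : V) (hx : x ≠ v) : G.hitVec v z x = z * G.outSum (G.hitVec v z) x := by
  rw [← toReal_firstHitSum_eq hz h, hitVec, if_neg hx]

variable [Fintype V]

theorem one_sub_smul_mulVec (z : ℝ) (y : V → ℝ) (x : V) :
    ((1 - z • G.adjacencyMatrix) *ᵥ y) x = y x - z * G.outSum y x := by
  rw [Matrix.sub_mulVec, Matrix.one_mulVec, Matrix.smul_mulVec, adjacencyMatrix_mulVec]
  rfl

/-- The renewal identity `p = p_v (1 - f)`. -/
theorem detPoly_eval_eq {z : ℝ} (hz : 0 < z) (h : ∀ u, G.firstHitSum v u (.ofReal z) ≠ ∞) :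
    G.detPoly.eval z = (G.minorPoly v).eval z * (1 - G.loopSum v z) := by
  rw [detPoly_eval, minorPoly_eval]
  refine Matrix.det_eq_minor_mul _ v (G.hitVec v z) _ (hitVec_self z) (funext fun x => ?_)
  rw [one_sub_smul_mulVec]
  by_cases hx : x = v
  · subst hx
    rw [← toReal_firstHitSum_eq hz h, hitVec_self, Pi.single_eq_same, loopSum]
  · rw [Pi.single_eq_of_ne hx, ← hitVec_of_ne hz h x hx, sub_self]

/-- A null vector w of the matrix with row v replaced vanishes at v and is harmonic elsewhere. Then
|w| is subharmonic off v, and the maximum principle bounds it by 0. -/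
theorem minorPoly_eval_ne_zero [Nonempty E] (hG : G.StronglyConnected) {z : ℝ} (hz : 0 < z)
    (h : ∀ u, G.firstHitSum v u (.ofReal z) ≠ ∞) : (G.minorPoly v).eval z ≠ 0 := by
  rw [minorPoly_eval]
  intro h0
  obtain ⟨w, hw, hw0⟩ := Matrix.exists_mulVec_eq_zero_iff.2 h0
  have hwv : w v = 0 := by
    have := congrFun hw0 v
    simpa [Matrix.mulVec, Matrix.updateRow_self] using this
  have hwx : ∀ x, x ≠ v → w x = z * G.outSum w x := by
    intro x hx
    have h1 := congrFun hw0 x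
    have h2 : (((1 - z • G.adjacencyMatrix).updateRow v (Pi.single v 1)) *ᵥ w) x =
        ((1 - z • G.adjacencyMatrix) *ᵥ w) x := by
      simp only [Matrix.mulVec, Matrix.updateRow_ne hx]
    rw [h2, one_sub_smul_mulVec, Pi.zero_apply] at h1
    linarith
  have key := le_mul_of_subharmonic hG hz (y := fun x => |w x|) (hitVec_pos hG hz h)
    (hitVec_self z) (fun x hx => ?_) (hitVec_of_ne hz h)
  · apply hw
    funext x
    have := key x
    simp only [hwv, abs_zero, zero_mul] at this
    exact abs_eq_zero.1 (le_antisymm this (abs_nonneg _))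
  · rw [hwx x hx, abs_mul, abs_of_pos hz]
    refine mul_le_mul_of_nonneg_left ((Finset.abs_sum_le_sum_abs _ _).trans (le_of_eq ?_)) hz.le
    refine Finset.sum_congr rfl fun e _ => ?_
    split_ifs <;> simp

theorem minorPoly_eval_pos [Nonempty E] (hG : G.StronglyConnected) {z : ℝ} (hz : 0 < z)
    (h : G.firstHitSum v v (.ofReal z) ≠ ∞) : 0 < (G.minorPoly v).eval z := by
  refine Polynomial.eval_pos_of_ne_zero (by simp [minorPoly_eval_zero]) hz.le fun x hx hxz => ?_
  refine minorPoly_eval_ne_zero hG hx (firstHitSum_ne_top_of_loop hG (by simpa using hx) ?_)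
  exact ne_top_of_le_ne_top h (firstHitSum_mono (ENNReal.ofReal_le_ofReal hxz) v)

end FirstHitSums

/-! ### The loop series up to the Perron radius -/

section Perron

variable [Fintype V] [DecidableEq V] [Fintype E] {G : DirectedGraph V E} {v : V}

theorem adjacencyMatrix_pow_nonneg (G : DirectedGraph V E) (n : ℕ) (i j : V) :
    0 ≤ (G.adjacencyMatrix ^ n) i j := by
  induction n generalizing i j with
  | zero => rw [pow_zero, Matrix.one_apply]; split_ifs <;> simp
  | succ n ih =>
    rw [pow_succ, Matrix.mul_apply]
    refine Finset.sum_nonneg fun k _ => mul_nonneg (ih i k) ?_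
    simp [adjacencyMatrix]

theorem adjacencyMatrix_pow_succ_apply (n : ℕ) (i j : V) :
    (G.adjacencyMatrix ^ (n + 1)) i j = G.outSum (fun x => (G.adjacencyMatrix ^ n) x j) i := by
  rw [← adjacencyMatrix_mulVec, pow_succ', Matrix.mul_apply]
  rfl

/-- The Green function ∑ zⁿ Aⁿ(u, v) is finite and is a supersolution: shifting n by one drops only
the term n = 0, and its value at v is at least the boundary value 1. -/
theorem firstHitSum_ne_top_of_lt {z : ℝ} (hz : 0 < z) (h : z * G.perronEigenvalue < 1) (u : V) :
    G.firstHitSum v u (.ofReal z) ≠ ∞ := by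
  have hsum := Matrix.summable_pow_entry G.adjacencyMatrix hz h
  refine ne_top_of_le_ne_top (hsum u v).tsum_ofReal_ne_top
    (firstHitSum_le_of_supersolution (Y := fun u => ∑' n : ℕ,
      ENNReal.ofReal (z ^ n * (G.adjacencyMatrix ^ n) u v)) (fun u => ?_) u)
  have hYv : (1 : ℝ≥0∞) ≤ ∑' n : ℕ, ENNReal.ofReal (z ^ n * (G.adjacencyMatrix ^ n) v v) := by
    refine le_trans ?_ (ENNReal.le_tsum 0)
    simp
  have h1 : ENNReal.ofReal z * G.outSum (fun x => ∑' n : ℕ,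
      ENNReal.ofReal (z ^ n * (G.adjacencyMatrix ^ n) x v)) u =
      ∑' n : ℕ, ENNReal.ofReal (z ^ (n + 1) * (G.adjacencyMatrix ^ (n + 1)) u v) := by
    simp only [adjacencyMatrix_pow_succ_apply, outSum]
    have : ∀ e : E, (if G.s e = u then ∑' n : ℕ,
        ENNReal.ofReal (z ^ n * (G.adjacencyMatrix ^ n) (G.r e) v) else 0) =
        ∑' n : ℕ, if G.s e = u then
          ENNReal.ofReal (z ^ n * (G.adjacencyMatrix ^ n) (G.r e) v) else 0 := by
      intro e; split_ifs <;> simp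
    simp_rw [this]
    rw [← Summable.tsum_finsetSum fun _ _ => ENNReal.summable, ← ENNReal.tsum_mul_left]
    refine tsum_congr fun n => ?_
    rw [pow_succ', mul_assoc, ENNReal.ofReal_mul hz.le]
    congr 1
    rw [Finset.mul_sum, ENNReal.ofReal_sum_of_nonneg]
    · refine Finset.sum_congr rfl fun e _ => ?_
      split_ifs <;> simp
    · intro e _
      split_ifs
      · exact mul_nonneg (by positivity) (adjacencyMatrix_pow_nonneg G _ _ _)
      · simp
  have h2 : (∑' n : ℕ, ENNReal.ofReal (z ^ (n + 1) * (G.adjacencyMatrix ^ (n + 1)) u v)) ≤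
      ∑' n : ℕ, ENNReal.ofReal (z ^ n * (G.adjacencyMatrix ^ n) u v) :=
    ENNReal.tsum_comp_le_tsum_of_injective (Nat.succ_injective)
      fun n => ENNReal.ofReal (z ^ n * (G.adjacencyMatrix ^ n) u v)
  refine le_trans ?_ (h1.le.trans h2)
  refine mul_le_mul_right (Finset.sum_le_sum fun e _ => ?_) _
  by_cases hs : G.s e = u
  · rw [if_pos hs, if_pos hs]
    dsimp only
    by_cases hr : G.r e = v
    · rw [if_pos hr, hr]; exact hYv
    · rw [if_neg hr]
  · rw [if_neg hs, if_neg hs]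

theorem loopSum_lt_one [Nonempty E] (hG : G.StronglyConnected) {z : ℝ} (hz : 0 < z)
    (h : z * G.perronEigenvalue < 1) : G.loopSum v z < 1 := by
  have h1 := firstHitSum_ne_top_of_lt (v := v) hz h
  have h2 := detPoly_eval_eq hz h1
  have h3 := minorPoly_eval_pos hG hz (h1 v)
  have h4 := detPoly_eval_pos hz h
  rw [h2] at h4
  linarith [pos_of_mul_pos_right h4 h3.le]

/-- At z = 1 each loop counts 1, so the loop series is at least 1; a Perron eigenvalue below 1 would
make it less than 1. -/
theorem one_le_perronEigenvalue [Nonempty E] (hG : G.StronglyConnected) :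
    1 ≤ G.perronEigenvalue := by
  obtain ⟨e⟩ := ‹Nonempty E›
  have : Nonempty E := ⟨e⟩
  by_contra! hcon
  have h0 : (1 : ℝ) * G.perronEigenvalue < 1 := by rwa [one_mul]
  have h1 := loopSum_lt_one (v := G.s e) hG one_pos h0
  have h2 := firstHitSum_ne_top_of_lt (v := G.s e) one_pos h0 (G.s e)
  have h3 := ENNReal.toReal_mono h2
    (by simpa using one_le_firstHitSum_one (v := G.s e) hG (G.s e))
  rw [ENNReal.toReal_one] at h3
  exact absurd h3 (not_le.2 h1)

theorem rho_pos [Nonempty E] (hG : G.StronglyConnected) : 0 < G.rho :=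
  inv_pos.2 (one_pos.trans_le (one_le_perronEigenvalue hG))

theorem rho_le_one [Nonempty E] (hG : G.StronglyConnected) : G.rho ≤ 1 :=
  inv_le_one_of_one_le₀ (one_le_perronEigenvalue hG)

theorem firstHitSum_rho_le_one [Nonempty E] (hG : G.StronglyConnected) :
    G.firstHitSum v v (.ofReal G.rho) ≤ 1 := by
  refine firstHitSum_le_of_forall_lt (rho_pos hG) fun w hw hwr => ?_
  have h1 : w * G.perronEigenvalue < 1 := by
    have hl := one_pos.trans_le (one_le_perronEigenvalue hG)
    rwa [rho, ← one_div, lt_div_iff₀ hl] at hwr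
  have h2 := firstHitSum_ne_top_of_lt (v := v) hw h1 v
  rw [← ENNReal.ofReal_toReal h2, ← ENNReal.ofReal_one]
  exact ENNReal.ofReal_le_ofReal (loopSum_lt_one hG hw h1).le

theorem firstHitSum_ne_top [Nonempty E] (hG : G.StronglyConnected) {z : ℝ} (hz : 0 < z)
    (hzr : z ≤ G.rho) (u : V) : G.firstHitSum v u (.ofReal z) ≠ ∞ := by
  refine firstHitSum_ne_top_of_loop hG (by simpa using hz) ?_ u
  exact ne_top_of_le_ne_top ENNReal.one_ne_top
    ((firstHitSum_mono (ENNReal.ofReal_le_ofReal hzr) v).trans (firstHitSum_rho_le_one hG))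

/-- The upper bound is left continuity. For the lower bound, an eigenvector y for an eigenvalue of
maximal modulus makes |y| subharmonic for z = ρ. The maximum principle gives |y| ≤ |y(v)| h with h =
`hitVec`, so y(v) ≠ 0, and one more step at v gives |y(v)| ≤ |y(v)| f(ρ). No positive eigenvector is
needed. -/
theorem loopSum_rho [Nonempty E] (hG : G.StronglyConnected) : G.loopSum v G.rho = 1 := by
  have hfin := firstHitSum_ne_top (v := v) hG (rho_pos hG) le_rfl
  apply le_antisymm
  · rw [← ENNReal.toReal_one]
    exact ENNReal.toReal_mono ENNReal.one_ne_top (firstHitSum_rho_le_one hG)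
  have : Nonempty V := ⟨v⟩
  obtain ⟨μ, y, hy, hμ, hnorm⟩ :=
    Matrix.exists_norm_eigenvalue_eq_spectralRadius (G.adjacencyMatrix.map (algebraMap ℝ ℂ))
  change ‖μ‖ = G.perronEigenvalue at hnorm
  rw [adjacencyMatrix_map_mulVec] at hμ
  have hl := one_pos.trans_le (one_le_perronEigenvalue hG)
  have hsub : ∀ x, ‖y x‖ ≤ G.rho * G.outSum (fun x => ‖y x‖) x := by
    intro x
    have h1 : ‖μ‖ * ‖y x‖ ≤ G.outSum (fun x => ‖y x‖) x := by
      rw [← norm_mul]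
      have h2 : μ * y x = G.outSum y x := by rw [hμ]; rfl
      rw [h2]
      refine (norm_sum_le _ _).trans (le_of_eq (Finset.sum_congr rfl fun e _ => ?_))
      split_ifs <;> simp
    rw [rho, inv_mul_eq_div, le_div_iff₀ hl, mul_comm, ← hnorm]
    exact h1
  have key := le_mul_of_subharmonic hG (rho_pos hG) (y := fun x => ‖y x‖)
    (hitVec_pos (v := v) hG (rho_pos hG) hfin) (hitVec_self _) (fun x _ => hsub x)
    (hitVec_of_ne (rho_pos hG) hfin)
  have hpos : 0 < ‖y v‖ := by
    by_contra! hcon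
    apply hy
    funext x
    have h1 := key x
    have h2 : ‖y v‖ = 0 := le_antisymm hcon (norm_nonneg _)
    simp only [h2, zero_mul] at h1
    exact norm_le_zero_iff.1 h1
  have h3 : ‖y v‖ ≤ ‖y v‖ * G.loopSum v G.rho := by
    rw [loopSum, toReal_firstHitSum_eq (rho_pos hG) hfin]
    calc ‖y v‖ ≤ G.rho * G.outSum (fun x => ‖y x‖) v := hsub v
      _ ≤ G.rho * G.outSum (fun x => ‖y v‖ * G.hitVec v G.rho x) v :=
        mul_le_mul_of_nonneg_left (outSum_mono G key v) (rho_pos hG).le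
      _ = _ := by rw [outSum_const_mul]; ring
  exact le_of_mul_le_mul_left (by simpa using h3) hpos

/-- On `(0, ρ]` the function `q_v` is `1` minus the generating function of the loops. -/
theorem q_eq [Nonempty E] (hG : G.StronglyConnected) {z : ℝ} (hz : 0 < z) (hzr : z ≤ G.rho) :
    G.q v z = 1 - G.loopSum v z := by
  have h := firstHitSum_ne_top (v := v) hG hz hzr
  rw [q, detPoly_eval_eq hz h, mul_div_cancel_left₀ _ (minorPoly_eval_pos hG hz (h v)).ne']

theorem convexOn_loopSum [Nonempty E] (hG : G.StronglyConnected) :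
    ConvexOn ℝ (Set.Ioc 0 G.rho) (G.loopSum v) := by
  refine ⟨convex_Ioc _ _, fun x hx y hy a b ha hb hab => ?_⟩
  have h1 := firstHitSum_add_le (G := G) (v := v) v ha hb hab hx.1.le hy.1.le
  have hx' := ENNReal.mul_ne_top ENNReal.ofReal_ne_top (firstHitSum_ne_top (v := v) hG hx.1 hx.2 v)
    (a := .ofReal a)
  have hy' := ENNReal.mul_ne_top ENNReal.ofReal_ne_top (firstHitSum_ne_top (v := v) hG hy.1 hy.2 v)
    (a := .ofReal b)
  have h2 := ENNReal.toReal_mono (ENNReal.add_ne_top.2 ⟨hx', hy'⟩) h1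
  rw [ENNReal.toReal_add hx' hy', ENNReal.toReal_mul, ENNReal.toReal_mul,
    ENNReal.toReal_ofReal ha, ENNReal.toReal_ofReal hb] at h2
  exact h2

end Perron

end DirectedGraph

/-! ### Entropy and the radius of convergence of the language series -/

section Entropy

open scoped ENNReal

variable {A : Type*} {X : Set (ℤ → A)}

theorem languageOfLength_nonempty (hX : X.Nonempty) (n : ℕ) : (languageOfLength X n).Nonempty := by
  obtain ⟨x, hx⟩ := hX
  exact ⟨fun k => x (0 + (k : ℕ)), x, hx, 0, fun _ => rfl⟩

theorem ncard_languageOfLength_pos [Finite A] (hX : X.Nonempty) (n : ℕ) :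
    0 < (languageOfLength X n).ncard :=
  (Set.ncard_pos).2 (languageOfLength_nonempty hX n)

/-- A word is determined by its prefix and suffix; this is the submultiplicativity behind Fekete's
lemma. -/
theorem ncard_languageOfLength_add_le [Finite A] (m n : ℕ) :
    (languageOfLength X (m + n)).ncard ≤
      (languageOfLength X m).ncard * (languageOfLength X n).ncard := by
  rw [← Set.ncard_prod]
  refine Set.ncard_le_ncard_of_injOn
    (fun w => (fun k => w (Fin.castAdd n k), fun k => w (Fin.natAdd m k))) ?_ ?_ (Set.toFinite _)
  · rintro w ⟨x, hx, i, hw⟩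
    refine ⟨⟨x, hx, i, fun k => hw _⟩, ⟨x, hx, i + m, fun k => (hw _).trans ?_⟩⟩
    simp [add_assoc]
  · intro w _ w' _ h
    obtain ⟨h1, h2⟩ := Prod.ext_iff.1 h
    funext k
    refine Fin.addCases (fun k => congrFun h1 k) (fun k => congrFun h2 k) k

/-- The topological entropy of a nonempty set of sequences exists. -/
theorem exists_hasTopologicalEntropy [Finite A] (hX : X.Nonempty) :
    ∃ h, HasTopologicalEntropy X h := by
  have hpos : ∀ n, (0 : ℝ) < ((languageOfLength X n).ncard : ℝ) := fun n => by
    exact_mod_cast ncard_languageOfLength_pos hX n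
  have hsub : Subadditive fun n => Real.log ((languageOfLength X n).ncard : ℝ) := by
    intro m n
    rw [← Real.log_mul (hpos m).ne' (hpos n).ne']
    refine Real.log_le_log (hpos _) ?_
    exact_mod_cast ncard_languageOfLength_add_le m n
  refine ⟨hsub.lim, (hsub.tendsto_lim ⟨0, ?_⟩).congr fun n => ?_⟩
  · rintro _ ⟨n, rfl⟩
    refine div_nonneg (Real.log_nonneg ?_) n.cast_nonneg
    exact_mod_cast ncard_languageOfLength_pos hX n
  · rw [one_div, inv_mul_eq_div]

theorem HasTopologicalEntropy.tsum_ne_top [Finite A] (hX : X.Nonempty) {h : ℝ}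
    (hh : HasTopologicalEntropy X h) {x : ℝ} (hx : 0 < x) (hxh : Real.log x < -h) :
    ∑' n : ℕ, ((languageOfLength X n).ncard : ℝ≥0∞) * ENNReal.ofReal x ^ n ≠ ∞ := by
  -- With h < r < -log x, the counts are eventually at most e^{rn}, and e^r x < 1.
  obtain ⟨r, hr1, hr2⟩ := exists_between (lt_neg.1 hxh)
  have hlt : Real.exp r * x < 1 := by
    rw [← Real.exp_log hx, ← Real.exp_add, Real.exp_lt_one_iff]
    linarith
  have hs : Summable fun n : ℕ => ((languageOfLength X n).ncard : ℝ) * x ^ n := by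
    refine Summable.of_norm_bounded_eventually_nat (g := fun n => (Real.exp r * x) ^ n)
      (summable_geometric_of_lt_one (by positivity) hlt) ?_
    filter_upwards [hh.eventually_lt_const hr1, eventually_gt_atTop 0] with n hn hn0
    have hn0' : (0 : ℝ) < n := by exact_mod_cast hn0
    have hc : (0 : ℝ) < ((languageOfLength X n).ncard : ℝ) := by
      exact_mod_cast ncard_languageOfLength_pos hX n
    rw [Real.norm_of_nonneg (by positivity), mul_pow]
    refine mul_le_mul_of_nonneg_right ?_ (by positivity)
    rw [one_div, inv_mul_lt_iff₀ hn0'] at hn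
    rw [← Real.exp_nat_mul, ← Real.exp_log hc]
    exact Real.exp_le_exp.2 hn.le
  have := hs.tsum_ofReal_ne_top
  refine ne_of_eq_of_ne (tsum_congr fun n => ?_) this
  rw [ENNReal.ofReal_mul (by positivity), ENNReal.ofReal_pow hx.le, ENNReal.ofReal_natCast]

end Entropy

/-! ### Convexity estimate near ρ and conclusion -/

namespace DirectedGraph

variable {V E : Type*} [Fintype V] [DecidableEq V] [Fintype E] [Nonempty E]
  {G : DirectedGraph V E} {v : V}

theorem rho_sq_lt_rho (hG : G.StronglyConnected) (hv : G.q v (G.rho ^ 2) > 3 / 4) :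
    G.rho ^ 2 < G.rho := by
  have h0 := rho_pos hG
  -- If ρ = 1, then q_v(ρ²) = q_v(ρ) = 1 - f(ρ) = 0.
  have h1 : G.rho ≠ 1 := fun h => by
    have hq := q_eq (v := v) hG h0 le_rfl
    rw [loopSum_rho hG, h] at hq
    rw [h, one_pow, hq] at hv
    norm_num at hv
  have h2 := lt_of_le_of_ne (rho_le_one hG) h1
  nlinarith

theorem detPoly_eval_rho (hG : G.StronglyConnected) (v : V) : G.detPoly.eval G.rho = 0 := by
  rw [detPoly_eval_eq (v := v) (rho_pos hG) (firstHitSum_ne_top hG (rho_pos hG) le_rfl),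
    loopSum_rho hG, sub_self, mul_zero]

/-- The left derivative of the generating function of the loops at `ρ`. -/
theorem hasDerivWithinAt_loopSum (hG : G.StronglyConnected) :
    HasDerivWithinAt (G.loopSum v)
      (-(G.detPoly.derivative.eval G.rho / (G.minorPoly v).eval G.rho)) (Set.Ioc 0 G.rho) G.rho := by
  have hr := rho_pos hG
  have hm := minorPoly_eval_pos (v := v) hG hr (firstHitSum_ne_top hG hr le_rfl v)
  have h1 := ((G.detPoly.hasDerivAt G.rho).div ((G.minorPoly v).hasDerivAt G.rho) hm.ne').const_sub 1
  -- Since p(ρ) = 0, the quotient rule for p / p_v reduces to p'(ρ) / p_v(ρ).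
  rw [detPoly_eval_rho hG v, zero_mul, sub_zero, sq, mul_div_mul_right _ _ hm.ne'] at h1
  refine h1.hasDerivWithinAt.congr (fun x hx => ?_) ?_
  · have := q_eq (v := v) hG hx.1 hx.2
    rw [q] at this
    simp [this]
  · have := q_eq (v := v) hG hr le_rfl
    rw [q] at this
    simp [this]

/-- The gain in terms of the left derivative D of f at ρ and t = √(q_v(ρ²) - 3/4). Positivity of D
comes from the chord over [ρ², ρ], as f(ρ²) < 1/4 and f(ρ) = 1; and t < 1/2 because f(ρ²) > 0. -/
theorem exists_entropyGain_eq (hG : G.StronglyConnected) (hv : G.q v (G.rho ^ 2) > 3 / 4) :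
    ∃ D t : ℝ, 0 < D ∧ 0 < t ∧ t < 1 / 2 ∧ t ^ 2 = 1 / 4 - G.loopSum v (G.rho ^ 2) ∧
      HasDerivWithinAt (G.loopSum v) D (Set.Ioc 0 G.rho) G.rho ∧
      G.entropyGain v = t * (1 / 2 - t) / (G.rho * D * (G.rho + t)) := by
  have hr := rho_pos hG
  have hr2 := rho_sq_lt_rho hG hv
  have hq := q_eq (v := v) hG (pow_pos hr 2) hr2.le
  have hm := minorPoly_eval_pos (v := v) hG hr (firstHitSum_ne_top hG hr le_rfl v)
  have hd := hasDerivWithinAt_loopSum (v := v) hG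
  have hf0 : 0 < G.loopSum v (G.rho ^ 2) :=
    ENNReal.toReal_pos (firstHitSum_ne_zero hG (by simpa using hr.ne') v)
      (firstHitSum_ne_top hG (pow_pos hr 2) hr2.le v)
  set D := -(G.detPoly.derivative.eval G.rho / (G.minorPoly v).eval G.rho) with hD
  have ht2 : √(G.q v (G.rho ^ 2) - 3 / 4) ^ 2 = G.q v (G.rho ^ 2) - 3 / 4 :=
    Real.sq_sqrt (by linarith)
  have ht0 : 0 < √(G.q v (G.rho ^ 2) - 3 / 4) := Real.sqrt_pos.2 (by linarith)
  set t := √(G.q v (G.rho ^ 2) - 3 / 4) with ht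
  have hDpos : 0 < D := by
    have h1 := (convexOn_loopSum (v := v) hG).slope_le_of_hasDerivWithinAt
      ⟨pow_pos hr 2, hr2.le⟩ ⟨hr, le_rfl⟩ hr2 hd
    refine lt_of_lt_of_le ?_ h1
    rw [slope_def_field, loopSum_rho hG]
    exact div_pos (by linarith) (by linarith)
  refine ⟨D, t, hDpos, ht0, by nlinarith, by rw [ht2, hq]; ring, hd, ?_⟩
  have hp : G.detPoly.derivative.eval G.rho = -D * (G.minorPoly v).eval G.rho := by
    rw [hD]; field_simp
  rw [entropyGain, ← ht, hp, ← ht2]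
  field_simp
  ring

/-- Just below `ρ` the generating function of the loops is large. -/
theorem lt_loopSum (hG : G.StronglyConnected) (hv : G.q v (G.rho ^ 2) > 3 / 4) {x : ℝ}
    (hx : 0 < x) (hxr : x < G.rho) (hxg : G.rho * (1 - G.entropyGain v) < x) :
    1 / 2 + √(1 / 4 - G.loopSum v (x ^ 2)) < G.loopSum v x := by
  obtain ⟨D, t, hD, ht, -, ht2, hd, hg⟩ := exists_entropyGain_eq hG hv
  have hr := rho_pos hG
  have hr2 := rho_sq_lt_rho hG hv
  have hx2 : x ^ 2 < G.rho ^ 2 := pow_lt_pow_left₀ hxr hx.le two_ne_zero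
  have hconv := convexOn_loopSum (v := v) hG
  have hmem : x ^ 2 ∈ Set.Ioc 0 G.rho := ⟨pow_pos hx 2, (hx2.trans hr2).le⟩
  have hmemr : G.rho ∈ Set.Ioc 0 G.rho := ⟨hr, le_rfl⟩
  -- Three slope comparisons: the chord over [x, ρ] has slope at most D, and so has the chord over
  -- [x², ρ²], through the chord over [ρ², ρ].
  have s1 := hconv.slope_le_of_hasDerivWithinAt ⟨hx, hxr.le⟩ hmemr hxr hd
  have s2 := hconv.slope_le_of_hasDerivWithinAt ⟨pow_pos hr 2, hr2.le⟩ hmemr hr2 hd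
  have s3 := hconv.slope_mono_adjacent hmem hmemr hx2 hr2
  rw [slope_def_field, div_le_iff₀ (by linarith), loopSum_rho hG] at s1
  rw [slope_def_field] at s2
  have s4 := s3.trans s2
  rw [div_le_iff₀ (by linarith)] at s4
  have hmono : G.loopSum v (x ^ 2) ≤ G.loopSum v (G.rho ^ 2) :=
    ENNReal.toReal_mono (firstHitSum_ne_top hG (pow_pos hr 2) hr2.le v)
      (firstHitSum_mono (ENNReal.ofReal_le_ofReal hx2.le) v)
  have hb : (G.rho - x) * (D * (G.rho + t)) < t * (1 / 2 - t) := by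
    rw [hg] at hxg
    have h1 : G.rho * (t * (1 / 2 - t) / (G.rho * D * (G.rho + t))) =
        t * (1 / 2 - t) / (D * (G.rho + t)) := by
      have : G.rho + t ≠ 0 := by positivity
      field_simp
    rw [mul_sub, mul_one, h1] at hxg
    rw [← lt_div_iff₀ (by positivity)]
    linarith
  set a := √(1 / 4 - G.loopSum v (x ^ 2)) with ha
  have ha2 : a ^ 2 = 1 / 4 - G.loopSum v (x ^ 2) :=
    Real.sq_sqrt (by nlinarith [sq_nonneg t])
  -- The square root is linearised by 2ta ≤ t² + a², and ρ² - x² = 2ρ(ρ - x) - (ρ - x)². With this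
  -- bound, f(x) > 1/2 + a follows from D(ρ - x)(ρ + t) < t(1/2 - t), which is `hb`; this is where
  -- the form of the gain comes from.
  have hamg : t * a ≤ t ^ 2 + D * (G.rho - x) * G.rho := by
    have e1 : 2 * t * a ≤ t ^ 2 + a ^ 2 := two_mul_le_add_sq t a
    have e2 : a ^ 2 - t ^ 2 ≤ D * (G.rho ^ 2 - x ^ 2) := by rw [ha2, ht2]; linarith
    have e3 : D * (G.rho ^ 2 - x ^ 2) ≤ 2 * (D * (G.rho - x) * G.rho) := by
      have : 0 ≤ D * (G.rho - x) ^ 2 := by positivity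
      nlinarith
    linarith
  have hfin : t * (1 / 2 + a) < t * (1 - D * (G.rho - x)) := by nlinarith
  have := lt_of_mul_lt_mul_left hfin ht.le
  linarith

end DirectedGraph

theorem theorem3p4 {V E : Type*} [Fintype V] [DecidableEq V] [Fintype E] [Nonempty E]
    (G : DirectedGraph V E) (hG : G.StronglyConnected) (v : V)
    (hv : G.q v (G.rho ^ 2) > 3 / 4) :
    0 < G.entropyGain v ∧
      ∃ h : ℝ, HasTopologicalEntropy (G.turnShift v) h ∧
        h > -Real.log G.rho + G.entropyGain v := by
  have hr := DirectedGraph.rho_pos hG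
  have hgain : 0 < G.entropyGain v := by
    obtain ⟨D, t, hD, ht, ht', -, -, hg⟩ := DirectedGraph.exists_entropyGain_eq hG hv
    rw [hg]
    have : 0 < 1 / 2 - t := by linarith
    positivity
  have hloop := DirectedGraph.exists_firstHit (v := v) hG v
  have hne := DirectedGraph.turnShift_nonempty hloop
  obtain ⟨h, hh⟩ := exists_hasTopologicalEntropy hne
  refine ⟨hgain, h, hh, ?_⟩
  by_contra! hcon
  have hexp : G.rho * (1 - G.entropyGain v) < G.rho * Real.exp (-G.entropyGain v) := by
    refine mul_lt_mul_of_pos_left ?_ hr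
    have := Real.add_one_lt_exp (neg_ne_zero.2 hgain.ne')
    linarith
  -- The maximum with 0 keeps x positive even if the gain exceeds 1. The upper bound gives log x <
  -- log ρ - gain ≤ -h.
  obtain ⟨x, hx1, hx2⟩ := exists_between (max_lt hexp (by positivity))
  have hx0 : 0 < x := (le_max_right _ _).trans_lt hx1
  have hxr : x < G.rho := hx2.trans_le
    (mul_le_of_le_one_right hr.le (Real.exp_le_one_iff.2 (by linarith)))
  have hlog : Real.log x < -h := by
    have := Real.log_lt_log hx0 hx2
    rw [Real.log_mul hr.ne' (Real.exp_ne_zero _), Real.log_exp] at this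
    linarith
  have h1 := DirectedGraph.firstHitSum_lt_of_tsum_ne_top hloop (by simpa using hx0)
    (hh.tsum_ne_top hne hx0 hlog)
  have h2 := DirectedGraph.lt_loopSum hG hv hx0 hxr ((le_max_left _ _).trans_lt hx1)
  rw [DirectedGraph.loopSum, DirectedGraph.loopSum, ENNReal.ofReal_pow hx0.le] at h2
  exact lt_asymm h1 h2
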